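/- Define integers $b(n)$, $n\ge 0$, by $$\mathcal B(q)=\sum_{n\ge 0}\frac{q^n(-q;q^2)_n}{(q;q^2)_{n+1}}=\sum_{n\ge 0}b(n)q^n,\qquad (a;q)_n=\prod_{j=0}^{n-1}(1-aq^j),$$ where $\mathcal B(q)$ is the second order mock theta function, viewed as a formal power series in $q$. Let $p\ge 5$ be a prime. (1) If $1\le \ell\le p-1$ and the Legendre symbol satisfies $\left(\frac{12\ell+9}{p}\right)=-1$, then for all $n\ge 0$, $$b\bigl(6(pn+\ell)+4\bigr)\equiv 0 \pmod{36}.$$ (2) For all $n,k\ge 0$, $$b(6n+4)\equiv 9^{-k-1}(-1)^{\frac{(k+1)(1-p)}{2}}p^{-k-1}\,b\!\left(6p^{2k+2}n+\frac{9p^{2k+2}-1}{2}\right)\pmod{36}.$$ Here $p^{-1}$ stands for any integer $v$ with $pv\equiv 1\pmod{36}$. As $9$ is not invertible modulo $36$, $9^{-1}$ stands for any integer $u$ with $9u\equiv 1\pmod 4$ (for instance $u=1$), and the congruence holds for every such choice of $u$ and $v$. It also holds with the denominators cleared: $$9^{k+1}p^{k+1}\,b(6n+4)\equiv(-1)^{\frac{(k+1)(1-p)}{2}}\,b\!\left(6p^{2k+2}n+\frac{9p^{2k+2}-1}{2}\right)\pmod{36}.$$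 -/

import Mathlib

open PowerSeries in
/-- The finite `q`-Pochhammer symbol `(a;q)_n = ∏_{j=0}^{n-1} (1 - a q^j)`, for `a` and `q`
in the ring of formal power series over `ℤ` in one variable `X` (which plays the role of `q`). -/
noncomputable def qPoch (a q : ℤ⟦X⟧) (n : ℕ) : ℤ⟦X⟧ :=
  ∏ j ∈ Finset.range n, (1 - a * q ^ j)

open PowerSeries in
/-- The `n`-th summand `q^n (-q;q^2)_n / (q;q^2)_{n+1}` of the second order mock theta function
`ℬ(q)`. The denominator has constant term `1`, and `invOfUnit _ 1` is its multiplicative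
inverse (see `mockThetaBTerm_mul`). -/
noncomputable def mockThetaBTerm (n : ℕ) : ℤ⟦X⟧ :=
  X ^ n * qPoch (-X) (X ^ 2) n * invOfUnit (qPoch X (X ^ 2) (n + 1)) 1

/-- The coefficients `b(m)` of `ℬ(q) = ∑_{n ≥ 0} q^n (-q;q^2)_n / (q;q^2)_{n+1}`. The `n`-th
summand is divisible by `q^n`, so only the summands with `n ≤ m` contribute to the coefficient
of `q^m` (see `coeff_mockThetaBTerm_of_lt` and `hasSum_mockThetaBTerm`). -/
noncomputable def mockThetaBCoeff (m : ℕ) : ℤ :=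
  ∑ n ∈ Finset.range (m + 1), PowerSeries.coeff m (mockThetaBTerm n)

open PowerSeries in
/-- The summands are the quotients they are meant to be. -/
theorem mockThetaBTerm_mul (n : ℕ) :
    mockThetaBTerm n * qPoch X (X ^ 2) (n + 1) = X ^ n * qPoch (-X) (X ^ 2) n := by
  have h : qPoch X (X ^ 2) (n + 1) * invOfUnit (qPoch X (X ^ 2) (n + 1)) 1 = 1 := by
    apply mul_invOfUnit
    simp [qPoch, map_prod]
  rw [mockThetaBTerm, mul_assoc, mul_comm (invOfUnit _ _), h, mul_one]

/-- The `n`-th summand has no terms of degree less than `n`. -/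
theorem coeff_mockThetaBTerm_of_lt {m n : ℕ} (h : m < n) :
    PowerSeries.coeff m (mockThetaBTerm n) = 0 := by
  rw [mockThetaBTerm, mul_assoc, PowerSeries.coeff_X_pow_mul', if_neg (by omega)]

open PowerSeries PowerSeries.WithPiTopology in
/-- The generating function of `b` is the sum of the series defining `ℬ(q)`, in the usual
topology of formal power series. -/
theorem hasSum_mockThetaBTerm :
    HasSum mockThetaBTerm (PowerSeries.mk mockThetaBCoeff) := by
  rw [PowerSeries.WithPiTopology.hasSum_iff_hasSum_coeff]
  intro m
  rw [PowerSeries.coeff_mk]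
  refine hasSum_sum_of_ne_finset_zero
    (f := fun n => PowerSeries.coeff m (mockThetaBTerm n)) fun n hn => ?_
  exact coeff_mockThetaBTerm_of_lt (by rw [Finset.mem_range] at hn; omega)

/-!
The two claims follow from a description of `b(6n + 4)` modulo `36`: it is congruent to `9` if
`n = 3m(m + 1)` for some `m`, and to `0` otherwise (`mockThetaBCoeff_six_mul_add_four`). The
condition says `12n + 9 = (3(2m + 1))²`, so it fails when `12n + 9` is a non-residue modulo `p`, and
it is invariant under `12n + 9 ↦ p^(2k+2) (12n + 9)` because `p` is prime to `6`. The remaining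
factors only matter modulo `4`, where `(-1)^((p-1)/2) ≡ p`.

Write `ψ(q) = ∑_{m ≥ 0} q^(m(m+1)/2)` and `φ(q) = ∑_{k ∈ ℤ} q^(k²)`.

* The even part of `ℬ`. Reversing the summation index turns the `n`-th summand of `ℬ(-q)` into the
  `(-n-1)`-st summand of `ℬ(q)`, so `ℬ(q) + ℬ(-q)` is a bilateral series, summed by a special case
  of Ramanujan's `₁ψ₁` formula (`mockThetaBSum_add_neg`). The proof follows Ismail: the bilateral
  series with a free lower parameter `β` satisfies a first-order functional equation in
  `β ↦ β q²` (`psiSum_shift`), which relates both `β = q` (the wanted series) and `β = 1` (where it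
  becomes a one-sided series summed by the `q`-binomial theorem) to `β = 0`. With Gauss's product
  for `ψ` (`psiPartial_mul_oddMinus`, by Shanks's finite identity) and `ψ(q)² = ψ(q²) φ(q)`
  (`thetaPsi_sq`), this gives `(∑ b(2n) q^n) φ(-q) = ψ(q)²` (`mockThetaBEven_mul_thetaPhiNeg`).

* The progression `3n + 2`. With `A = ∑ q^(k(3k+1)/2)` and `Ω = ∑ (-1)^k q^(k(3k+2))` one has
  `ψ(q) = A(q³) + q ψ(q⁹)` and `φ(-q) = φ(-q⁹) - 2q Ω(q³)`. Rationalising the denominator, the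
  coefficients in the class `2` modulo `3` have generating function
  `(2AΩ + φ(-q³)ψ(q³))² / (φ(-q³)³ - 8qΩ³)`. Since `AΩ = φ(-q³)ψ(q³)` (`thetaPent_mul_thetaOct`, a
  rearrangement of lattice sums that expresses arithmetic in `ℤ[√-2]` at the prime `3`), the
  numerator is `9 φ(-q³)² ψ(q³)²`.

* Modulo `4`, `φ(-q)² ≡ 1` and `φ(q)φ(-q) ≡ 1`, so one ninth of this generating function is
  congruent to `ψ(q³)² φ(-q³) = ψ(q⁶) φ(q³) φ(-q³) ≡ ψ(q⁶)`.

Infinite products never appear: identities between them are proved in an arbitrary commutative ring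
at an element `x` with `x ^ K = 0`, where all products and sums are finite, and are carried to
`ℤ⟦X⟧` through the quotients `ℤ⟦X⟧ / (X ^ K)`.
-/

/-! ### A bilateral basic hypergeometric series at a nilpotent base -/

section Nilpotent

variable {R : Type*} [CommRing R] {x : R} {K : ℕ}

theorem isUnit_one_sub_mul_of_pow_eq_zero (hx : x ^ K = 0) (z : R) : IsUnit (1 - x * z) :=
  IsNilpotent.isUnit_one_sub ⟨K, by rw [mul_pow, hx, zero_mul]⟩

theorem isUnit_one_add_mul_of_pow_eq_zero (hx : x ^ K = 0) (z : R) : IsUnit (1 + x * z) := by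
  simpa using isUnit_one_sub_mul_of_pow_eq_zero hx (-z)

/-- The term of non-negative index `n` of the bilateral series `∑ xⁿ (-x; x²)ₙ / (βx²; x²)ₙ`.
All inverses are `Ring.inverse`; the denominators are units once `x` is nilpotent. -/
noncomputable def psiUpper (x β : R) (n : ℕ) : R :=
  ∏ j ∈ Finset.range n, x * (1 + x ^ (2 * j + 1)) * Ring.inverse (1 - β * x ^ (2 * j + 2))

/-- The term of index `-m` of the bilateral series `∑ xⁿ (-x; x²)ₙ / (βx²; x²)ₙ`, after clearing
the negative powers of `x` that the shifted factorials of negative index contain. -/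
noncomputable def psiLower (x β : R) (m : ℕ) : R :=
  ∏ j ∈ Finset.range m, (x ^ (2 * j) - β) * Ring.inverse (1 + x ^ (2 * j + 1))

/-- The bilateral series `∑ xⁿ (-x; x²)ₙ / (βx²; x²)ₙ`, truncated where its terms vanish for
`x ^ K = 0`: the indices run from `-(K + 1)` to `K - 1`. -/
noncomputable def psiSum (x β : R) (K : ℕ) : R :=
  ∑ n ∈ Finset.range K, psiUpper x β n + ∑ m ∈ Finset.range (K + 1), psiLower x β (m + 1)

theorem inverse_one_sub_mul_pow (hx : x ^ K = 0) (β : R) (i : ℕ) :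
    (1 - β * x ^ (i + 1)) * Ring.inverse (1 - β * x ^ (i + 1)) = 1 := by
  have h : 1 - β * x ^ (i + 1) = 1 - x * (β * x ^ i) := by ring
  exact Ring.mul_inverse_cancel _ (h ▸ isUnit_one_sub_mul_of_pow_eq_zero hx _)

theorem inverse_one_add_pow (hx : x ^ K = 0) (i : ℕ) :
    (1 + x ^ (i + 1)) * Ring.inverse (1 + x ^ (i + 1)) = 1 := by
  have h : 1 + x ^ (i + 1) = 1 + x * x ^ i := by ring
  exact Ring.mul_inverse_cancel _ (h ▸ isUnit_one_add_mul_of_pow_eq_zero hx _)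

theorem psiUpper_shift (hx : x ^ K = 0) (β : R) (n : ℕ) :
    psiUpper x β n * (1 - β * x ^ 2) = psiUpper x (β * x ^ 2) n * (1 - β * x ^ (2 * n + 2)) := by
  induction n with
  | zero => simp [psiUpper]
  | succ n ih =>
    have h1 := inverse_one_sub_mul_pow hx β (2 * n + 1)
    have h2 := inverse_one_sub_mul_pow hx (β * x ^ 2) (2 * n + 1)
    rw [psiUpper, psiUpper, Finset.prod_range_succ, Finset.prod_range_succ]
    rw [psiUpper, psiUpper] at ih
    rw [show 2 * (n + 1) + 2 = 2 * n + 1 + 1 + 2 by ring, pow_add x (2 * n + 1 + 1) 2]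
    rw [show 2 * n + 2 = 2 * n + 1 + 1 by ring] at ih ⊢
    set A := ∏ j ∈ Finset.range n, x * (1 + x ^ (2 * j + 1)) * Ring.inverse (1 - β * x ^ (2 * j + 2))
    set B := ∏ j ∈ Finset.range n,
      x * (1 + x ^ (2 * j + 1)) * Ring.inverse (1 - β * x ^ 2 * x ^ (2 * j + 2))
    set I := Ring.inverse (1 - β * x ^ (2 * n + 1 + 1))
    set J := Ring.inverse (1 - β * x ^ 2 * x ^ (2 * n + 1 + 1))
    linear_combination x * (1 + x ^ (2 * n + 1)) * I * ih
      + B * (x * (1 + x ^ (2 * n + 1))) * h1 - B * (x * (1 + x ^ (2 * n + 1))) * h2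

/-- The termwise form `tₙ(β) + β tₙ₊₁(β) = (1 + βx) / (1 - βx²) · tₙ(βx²)` of the functional equation
`psiSum_shift`, for `n ≥ 0`. -/
theorem psiUpper_contiguous (hx : x ^ K = 0) (β : R) (n : ℕ) :
    (psiUpper x β n + β * psiUpper x β (n + 1)) * (1 - β * x ^ 2) =
      (1 + β * x) * psiUpper x (β * x ^ 2) n := by
  have h := psiUpper_shift hx β n
  have h1 := inverse_one_sub_mul_pow hx β (2 * n + 1)
  have h2 : psiUpper x β (n + 1) =
      psiUpper x β n * (x * (1 + x ^ (2 * n + 1)) * Ring.inverse (1 - β * x ^ (2 * n + 2))) :=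
    Finset.prod_range_succ _ _
  rw [h2]
  rw [show 2 * n + 2 = 2 * n + 1 + 1 by ring] at h ⊢
  set I := Ring.inverse (1 - β * x ^ (2 * n + 1 + 1))
  set A := psiUpper x β n
  set B := psiUpper x (β * x ^ 2) n
  linear_combination (1 + β * (x * (1 + x ^ (2 * n + 1)) * I)) * h
    + B * (β * (x * (1 + x ^ (2 * n + 1)))) * h1

theorem psiLower_shift (β : R) (m : ℕ) :
    psiLower x (β * x ^ 2) (m + 1) =
      (1 - β * x ^ 2) * x ^ (2 * m) * psiLower x β m * Ring.inverse (1 + x ^ (2 * m + 1)) := by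
  induction m with
  | zero => simp [psiLower]
  | succ m ih =>
    rw [psiLower, Finset.prod_range_succ, ← psiLower, ih, psiLower, psiLower,
      Finset.prod_range_succ]
    ring

/-- The termwise form of the functional equation `psiSum_shift` for negative indices. -/
theorem psiLower_contiguous (hx : x ^ K = 0) (β : R) (m : ℕ) :
    (psiLower x β (m + 1) + β * psiLower x β m) * (1 - β * x ^ 2) =
      (1 + β * x) * psiLower x (β * x ^ 2) (m + 1) := by
  have h1 := inverse_one_add_pow hx (2 * m)
  have h2 : psiLower x β (m + 1) =
      psiLower x β m * ((x ^ (2 * m) - β) * Ring.inverse (1 + x ^ (2 * m + 1))) :=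
    Finset.prod_range_succ _ _
  rw [psiLower_shift, h2]
  set I := Ring.inverse (1 + x ^ (2 * m + 1))
  linear_combination -(psiLower x β m * β * (1 - β * x ^ 2)) * h1

theorem psiUpper_eq_zero (hx : x ^ K = 0) (β : R) : psiUpper x β K = 0 := by
  simp_rw [psiUpper, mul_assoc x, Finset.prod_mul_distrib, Finset.prod_const, Finset.card_range, hx,
    zero_mul]

theorem psiLower_eq_zero (hx : x ^ K = 0) {β : R} (hβ : x ∣ β ∨ β = 1) :
    psiLower x β (K + 1) = 0 := by
  rw [psiLower, Finset.prod_range_succ']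
  rcases hβ with ⟨γ, rfl⟩ | rfl
  · have : ∀ j, (x ^ (2 * (j + 1)) - x * γ) * Ring.inverse (1 + x ^ (2 * (j + 1) + 1)) =
        x * ((x ^ (2 * j + 1) - γ) * Ring.inverse (1 + x ^ (2 * (j + 1) + 1))) := fun j => by ring
    simp_rw [this, Finset.prod_mul_distrib, Finset.prod_const, Finset.card_range, hx, zero_mul]
  · simp

/-- The functional equation in the lower parameter. The case `β = 1` is included: there the part of
negative index vanishes. -/
theorem psiSum_shift (hx : x ^ K = 0) {β : R} (hβ : x ∣ β ∨ β = 1) :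
    (1 + β) * (1 - β * x ^ 2) * psiSum x β K = (1 + β * x) * psiSum x (β * x ^ 2) K := by
  have hu : ∑ n ∈ Finset.range K, psiUpper x β (n + 1) + 1 =
      ∑ n ∈ Finset.range K, psiUpper x β n := by
    have := Finset.sum_range_succ (psiUpper x β) K
    rw [Finset.sum_range_succ', psiUpper_eq_zero hx, add_zero] at this
    simpa [psiUpper] using this
  have hl : ∑ m ∈ Finset.range (K + 1), psiLower x β m =
      ∑ m ∈ Finset.range (K + 1), psiLower x β (m + 1) + 1 := by
    have := Finset.sum_range_succ (psiLower x β) (K + 1)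
    rw [Finset.sum_range_succ', psiLower_eq_zero hx hβ, add_zero] at this
    simpa [psiLower] using this.symm
  have h1 := Finset.sum_congr (rfl : Finset.range K = _)
    fun n _ => psiUpper_contiguous hx β n
  have h2 := Finset.sum_congr (rfl : Finset.range (K + 1) = _)
    fun n _ => psiLower_contiguous hx β n
  rw [← Finset.sum_mul, ← Finset.mul_sum, Finset.sum_add_distrib, ← Finset.mul_sum] at h1 h2
  rw [psiSum, psiSum]
  linear_combination h1 + h2 - β * (1 - β * x ^ 2) * hu - β * (1 - β * x ^ 2) * hl

theorem psiSum_iterate (hx : x ^ K = 0) {β : R} (hβ : x ∣ β ∨ β = 1) (k : ℕ) :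
    (∏ i ∈ Finset.range k, (1 + β * x ^ (2 * i)) * (1 - β * x ^ (2 * i + 2))) * psiSum x β K =
      (∏ i ∈ Finset.range k, (1 + β * x ^ (2 * i + 1))) * psiSum x (β * x ^ (2 * k)) K := by
  induction k with
  | zero => simp
  | succ k ih =>
    have h : x ∣ β * x ^ (2 * k) ∨ β * x ^ (2 * k) = 1 := by
      rcases k with _ | k
      · simpa using hβ
      · exact Or.inl (Dvd.intro (β * x ^ (2 * k + 1)) (by ring))
    have h1 := psiSum_shift hx h
    rw [Finset.prod_range_succ, Finset.prod_range_succ,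
      show β * x ^ (2 * (k + 1)) = β * x ^ (2 * k) * x ^ 2 by ring]
    linear_combination (1 + β * x ^ (2 * k)) * (1 - β * x ^ (2 * k + 2)) * ih
      + (∏ i ∈ Finset.range k, (1 + β * x ^ (2 * i + 1))) * h1

/-- The series `∑ zⁿ (-x; x²)ₙ / (x²; x²)ₙ` of the `q`-binomial theorem, truncated where its terms
vanish for `x ∣ z` and `x ^ K = 0`. -/
noncomputable def qBinomialSum (x z : R) (K : ℕ) : R :=
  ∑ n ∈ Finset.range K, z ^ n *
    ∏ j ∈ Finset.range n, (1 + x ^ (2 * j + 1)) * Ring.inverse (1 - x ^ (2 * j + 2))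

theorem qBinomialSum_shift (hx : x ^ K = 0) {z : R} (hz : x ∣ z) :
    (1 - z) * qBinomialSum x z K = (1 + x * z) * qBinomialSum x (z * x ^ 2) K := by
  obtain ⟨w, rfl⟩ := hz
  set c : ℕ → R := fun n =>
    ∏ j ∈ Finset.range n, (1 + x ^ (2 * j + 1)) * Ring.inverse (1 - x ^ (2 * j + 2))
  have hc : ∀ n, c (n + 1) * (1 - x ^ (2 * n + 2)) = c n * (1 + x ^ (2 * n + 1)) := by
    intro n
    have h := inverse_one_sub_mul_pow hx 1 (2 * n + 1)
    rw [one_mul] at h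
    have h2 : c (n + 1) = c n * ((1 + x ^ (2 * n + 1)) * Ring.inverse (1 - x ^ (2 * n + 2))) :=
      Finset.prod_range_succ _ _
    rw [h2]
    linear_combination c n * (1 + x ^ (2 * n + 1)) * h
  have key := Finset.sum_range_sub (fun n => c n * (1 - x ^ (2 * n)) * (x * w) ^ n) K
  rw [mul_pow, hx] at key
  simp only [zero_mul, mul_zero, pow_zero, sub_self] at key
  change (1 - x * w) * ∑ n ∈ Finset.range K, (x * w) ^ n * c n =
    (1 + x * (x * w)) * ∑ n ∈ Finset.range K, (x * w * x ^ 2) ^ n * c n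
  rw [← sub_eq_zero, Finset.mul_sum, Finset.mul_sum, ← Finset.sum_sub_distrib, ← neg_eq_zero,
    ← Finset.sum_neg_distrib, ← key]
  refine Finset.sum_congr rfl fun n _ => ?_
  rw [mul_pow (x * w) (x ^ 2) n, ← pow_mul]
  linear_combination -(x * w) ^ (n + 1) * hc n

theorem qBinomialSum_iterate (hx : x ^ K = 0) (k : ℕ) :
    (∏ i ∈ Finset.range k, (1 - x ^ (2 * i + 1))) * qBinomialSum x x K =
      (∏ i ∈ Finset.range k, (1 + x ^ (2 * i + 2))) * qBinomialSum x (x ^ (2 * k + 1)) K := by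
  induction k with
  | zero => simp
  | succ k ih =>
    have h1 := qBinomialSum_shift hx (z := x ^ (2 * k + 1)) (Dvd.intro (x ^ (2 * k)) (by ring))
    rw [Finset.prod_range_succ, Finset.prod_range_succ,
      show x ^ (2 * (k + 1) + 1) = x ^ (2 * k + 1) * x ^ 2 by ring]
    linear_combination (1 - x ^ (2 * k + 1)) * ih
      + (∏ i ∈ Finset.range k, (1 + x ^ (2 * i + 2))) * h1

/-! ### Finite Euler products -/

/-- The truncation `∏_{1 ≤ i ≤ K} (1 + xⁱ)` of `(-x; x)_∞`. -/
def eulerPlus (x : R) (K : ℕ) : R := ∏ i ∈ Finset.range K, (1 + x ^ (i + 1))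

/-- The truncation `∏_{1 ≤ i ≤ K} (1 - xⁱ)` of `(x; x)_∞`. -/
def eulerMinus (x : R) (K : ℕ) : R := ∏ i ∈ Finset.range K, (1 - x ^ (i + 1))

/-- The truncation of `(-x; x²)_∞` to its first `K` factors. -/
def oddPlus (x : R) (K : ℕ) : R := ∏ i ∈ Finset.range K, (1 + x ^ (2 * i + 1))

/-- The truncation of `(x; x²)_∞` to its first `K` factors. -/
def oddMinus (x : R) (K : ℕ) : R := ∏ i ∈ Finset.range K, (1 - x ^ (2 * i + 1))

theorem oddMinus_neg (x : R) (K : ℕ) : oddMinus (-x) K = oddPlus x K := by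
  refine Finset.prod_congr rfl fun i _ => ?_
  rw [Odd.neg_pow ⟨i, rfl⟩, sub_neg_eq_add]

theorem eulerMinus_mul_eulerPlus (x : R) (K : ℕ) :
    eulerMinus x K * eulerPlus x K = eulerMinus (x ^ 2) K := by
  rw [eulerMinus, eulerPlus, eulerMinus, ← Finset.prod_mul_distrib]
  exact Finset.prod_congr rfl fun i _ => by ring

theorem eulerMinus_two_mul (x : R) (k : ℕ) :
    eulerMinus x (2 * k) = oddMinus x k * eulerMinus (x ^ 2) k := by
  induction k with
  | zero => simp [eulerMinus, oddMinus]
  | succ k ih =>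
    rw [show 2 * (k + 1) = 2 * k + 1 + 1 by ring, eulerMinus, Finset.prod_range_succ,
      Finset.prod_range_succ, ← eulerMinus, ih, eulerMinus, eulerMinus, oddMinus, oddMinus,
      Finset.prod_range_succ, Finset.prod_range_succ]
    ring

theorem eulerPlus_two_mul (x : R) (k : ℕ) :
    eulerPlus x (2 * k) = oddPlus x k * eulerPlus (x ^ 2) k := by
  induction k with
  | zero => simp [eulerPlus, oddPlus]
  | succ k ih =>
    rw [show 2 * (k + 1) = 2 * k + 1 + 1 by ring, eulerPlus, Finset.prod_range_succ,
      Finset.prod_range_succ, ← eulerPlus, ih, eulerPlus, eulerPlus, oddPlus, oddPlus,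
      Finset.prod_range_succ, Finset.prod_range_succ]
    ring

theorem pow_eq_zero_of_ge (hx : x ^ K = 0) {n : ℕ} (h : K ≤ n) : x ^ n = 0 := by
  rw [← Nat.sub_add_cancel h, pow_add, hx, mul_zero]

theorem eulerMinus_eq (hx : x ^ K = 0) :
    eulerMinus x K = oddMinus x K * eulerMinus (x ^ 2) K := by
  have h : ∀ i, x ^ (K + i + 1) = 0 := fun i => pow_eq_zero_of_ge hx (by omega)
  rw [← eulerMinus_two_mul, two_mul]
  simp [eulerMinus, Finset.prod_range_add, h]

theorem eulerPlus_eq (hx : x ^ K = 0) :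
    eulerPlus x K = oddPlus x K * eulerPlus (x ^ 2) K := by
  have h : ∀ i, x ^ (K + i + 1) = 0 := fun i => pow_eq_zero_of_ge hx (by omega)
  rw [← eulerPlus_two_mul, two_mul]
  simp [eulerPlus, Finset.prod_range_add, h]

theorem isUnit_eulerMinus (hx : x ^ K = 0) (k : ℕ) : IsUnit (eulerMinus x k) := by
  rw [eulerMinus, IsUnit.prod_iff]
  intro i _
  rw [pow_succ']
  exact isUnit_one_sub_mul_of_pow_eq_zero hx _

theorem isUnit_oddPlus (hx : x ^ K = 0) (k : ℕ) : IsUnit (oddPlus x k) := by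
  rw [oddPlus, IsUnit.prod_iff]
  intro i _
  rw [pow_succ']
  exact isUnit_one_add_mul_of_pow_eq_zero hx _

theorem sq_pow_eq_zero (hx : x ^ K = 0) : (x ^ 2) ^ K = 0 := by
  rw [← pow_mul, two_mul, pow_add, hx, zero_mul]

/-- Euler's identity: partitions into distinct parts and into odd parts are equinumerous. -/
theorem eulerPlus_mul_oddMinus (hx : x ^ K = 0) : eulerPlus x K * oddMinus x K = 1 := by
  have h1 := eulerMinus_mul_eulerPlus x K
  have h2 := eulerMinus_eq hx
  refine (isUnit_eulerMinus (sq_pow_eq_zero hx) K).mul_right_cancel ?_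
  linear_combination h1 - eulerPlus x K * h2

/-! ### The even part of the mock theta function as a product -/

/-- The series `ℬ` at a ring element `x`, truncated where its terms vanish for `x ^ K = 0`. -/
noncomputable def mockThetaBSum (x : R) (K : ℕ) : R :=
  ∑ n ∈ Finset.range K, x ^ n * (∏ j ∈ Finset.range n, (1 + x ^ (2 * j + 1))) *
    ∏ j ∈ Finset.range (n + 1), Ring.inverse (1 - x ^ (2 * j + 1))

/-- At `β = x` the terms of negative index are those of `ℬ(-x)`, in reverse order. -/
theorem psiSum_self (hx : x ^ K = 0) :
    psiSum x x K = (1 - x) * (mockThetaBSum x K + mockThetaBSum (-x) K) := by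
  have h0 : (1 - x) * Ring.inverse (1 - x) = 1 := by
    simpa using inverse_one_sub_mul_pow hx 1 0
  have hu : ∀ n, psiUpper x x n = (1 - x) * (x ^ n *
      (∏ j ∈ Finset.range n, (1 + x ^ (2 * j + 1))) *
      ∏ j ∈ Finset.range (n + 1), Ring.inverse (1 - x ^ (2 * j + 1))) := by
    intro n
    have h : ∀ j, 1 - x * x ^ (2 * j + 2) = 1 - x ^ (2 * (j + 1) + 1) := fun j => by ring
    simp_rw [psiUpper, Finset.prod_mul_distrib, Finset.prod_const, Finset.card_range, h,
      Finset.prod_range_succ' _ n]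
    rw [mul_zero, zero_add, pow_one]
    linear_combination -(x ^ n * (∏ j ∈ Finset.range n, (1 + x ^ (2 * j + 1))) *
      ∏ j ∈ Finset.range n, Ring.inverse (1 - x ^ (2 * (j + 1) + 1))) * h0
  have hl : ∀ n, psiLower x x (n + 1) = (1 - x) * ((-x) ^ n *
      (∏ j ∈ Finset.range n, (1 + (-x) ^ (2 * j + 1))) *
      ∏ j ∈ Finset.range (n + 1), Ring.inverse (1 - (-x) ^ (2 * j + 1))) := by
    intro n
    have h : ∀ j, x ^ (2 * (j + 1)) - x = (-x) * (1 - x ^ (2 * j + 1)) := fun j => by ring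
    have h' : ∀ j : ℕ, (-x) ^ (2 * j + 1) = -x ^ (2 * j + 1) := fun j => Odd.neg_pow ⟨j, rfl⟩ x
    simp_rw [psiLower, Finset.prod_mul_distrib, h', sub_neg_eq_add, ← sub_eq_add_neg,
      Finset.prod_range_succ' (fun j => x ^ (2 * j) - x) n, h, Finset.prod_mul_distrib,
      Finset.prod_const, Finset.card_range]
    ring

  have hK : (-x) ^ K = 0 := by rw [neg_pow, hx, mul_zero]
  rw [psiSum, Finset.sum_range_succ, hl K, mockThetaBSum, mockThetaBSum, mul_add, Finset.mul_sum,
    Finset.mul_sum, hK, zero_mul, zero_mul, mul_zero, add_zero,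
    Finset.sum_congr rfl fun n _ => hu n, Finset.sum_congr rfl fun n _ => hl n]

theorem prod_range_one_add_shift (hx : x ^ K = 0) :
    ∏ i ∈ Finset.range K, (1 + x ^ (2 * i)) = 2 * eulerPlus (x ^ 2) K := by
  have h := Finset.prod_range_succ (fun i => 1 + x ^ (2 * i)) K
  rw [Finset.prod_range_succ', pow_eq_zero_of_ge hx (show K ≤ 2 * K by omega), add_zero,
    mul_one] at h
  rw [← h, eulerPlus, mul_zero, pow_zero, one_add_one_eq_two, mul_comm]
  simp_rw [← pow_mul]

theorem one_sub_mul_prod_range (hx : x ^ K = 0) :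
    (1 - x) * ∏ i ∈ Finset.range K, (1 - x * x ^ (2 * i + 2)) = oddMinus x K := by
  have h := Finset.prod_range_succ (fun i => 1 - x ^ (2 * i + 1)) K
  rw [Finset.prod_range_succ', pow_eq_zero_of_ge hx (show K ≤ 2 * K + 1 by omega), sub_zero,
    mul_one, mul_zero, zero_add, pow_one] at h
  rw [oddMinus, ← h, mul_comm]
  congr 1
  exact Finset.prod_congr rfl fun i _ => by ring

theorem qBinomialSum_zero (hx : x ^ K = 0) : qBinomialSum x 0 K = 1 := by
  rcases K with _ | K
  · exact (subsingleton_of_zero_eq_one (by simpa using hx.symm)).elim _ _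
  · rw [qBinomialSum, Finset.sum_range_succ']
    simp

theorem psiSum_one : psiSum x 1 K = qBinomialSum x x K := by
  have h : ∀ m, psiLower x 1 (m + 1) = 0 := fun m => by
    rw [psiLower, Finset.prod_range_succ']
    simp
  simp_rw [psiSum, h, Finset.sum_const_zero, add_zero, qBinomialSum, psiUpper, one_mul, mul_assoc x,
    Finset.prod_mul_distrib, Finset.prod_const, Finset.card_range]

/-- Twice the even part of `ℬ(q)` is `2 (-q²; q²)_∞⁵ (q²; q²)_∞`: this is Ramanujan's `₁ψ₁` summation
at `a = -q`, `b = q³`, `z = q` in base `q²`. -/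
theorem mockThetaBSum_add_neg (hx : x ^ K = 0) :
    mockThetaBSum x K + mockThetaBSum (-x) K =
      2 * eulerPlus (x ^ 2) K ^ 5 * eulerMinus (x ^ 2) K := by
  have hp : ∏ i ∈ Finset.range K, (1 + x ^ (2 * i + 2)) = eulerPlus (x ^ 2) K := by
    simp_rw [eulerPlus, ← pow_mul, mul_add]
  have hm : ∏ i ∈ Finset.range K, (1 - x ^ (2 * i + 2)) = eulerMinus (x ^ 2) K := by
    simp_rw [eulerMinus, ← pow_mul, mul_add]
  have hg := qBinomialSum_iterate hx K
  rw [pow_eq_zero_of_ge hx (show K ≤ 2 * K + 1 by omega), qBinomialSum_zero hx, ← oddMinus, hp,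
    mul_one] at hg
  have h1 := psiSum_iterate hx (β := 1) (Or.inr rfl) K
  have h2 := psiSum_iterate hx (β := x) (Or.inl dvd_rfl) K
  rw [psiSum_one] at h1
  rw [psiSum_self hx] at h2
  simp_rw [pow_eq_zero_of_ge hx (show K ≤ 2 * K by omega), mul_zero, one_mul,
    Finset.prod_mul_distrib] at h1 h2
  rw [prod_range_one_add_shift hx, ← oddPlus, hm] at h1
  have h3 := one_sub_mul_prod_range hx
  have h4 : ∏ i ∈ Finset.range K, (1 + x * x ^ (2 * i)) = oddPlus x K := by
    simp_rw [oddPlus, pow_succ']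
  have h5 : ∏ i ∈ Finset.range K, (1 + x * x ^ (2 * i + 1)) = eulerPlus (x ^ 2) K := by
    rw [← hp]
    exact Finset.prod_congr rfl fun i _ => by ring
  rw [h4, h5] at h2
  -- Euler's identity in base `x ^ 2`, split as `(x; x ^ 2) (-x; x ^ 2) (-x ^ 2; x ^ 2) = 1`
  have h6 := eulerPlus_mul_oddMinus hx
  rw [eulerPlus_eq hx] at h6
  set S := mockThetaBSum x K + mockThetaBSum (-x) K
  set T := ∏ i ∈ Finset.range K, (1 - x * x ^ (2 * i + 2))
  set a := oddPlus x K
  set b := oddMinus x K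
  set p := eulerPlus (x ^ 2) K
  set m := eulerMinus (x ^ 2) K
  set f := psiSum x 0 K
  set g := qBinomialSum x x K
  have h7 : a * b * S = p * f := by linear_combination h2 - a * S * h3
  have h8 : a * b * f = 2 * p ^ 2 * m := by linear_combination -b * h1 + 2 * p * m * hg
  have h9 : a * b * p = 1 := by linear_combination h6
  linear_combination p ^ 2 * a * b * h7 + p ^ 3 * h8 - S * (a * b * p + 1) * h9

/-! ### Gauss's product for triangular numbers -/

/-- Shanks's finite form of Gauss's product for the generating function of the triangular numbers.
For large `n` only the term `s = 0` on the right survives. -/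
theorem shanks (hx : x ^ K = 0) (n : ℕ) :
    ∑ s ∈ Finset.range (2 * n), x ^ (s * (s + 1) / 2) =
      ∑ s ∈ Finset.range n, x ^ (s * (2 * n + 1)) *
        ∏ k ∈ Finset.Ico s n, (1 - x ^ (2 * k + 2)) * Ring.inverse (1 - x ^ (2 * k + 1)) := by
  induction n with
  | zero => simp
  | succ n ih =>
    set r : ℕ → R := fun k => (1 - x ^ (2 * k + 2)) * Ring.inverse (1 - x ^ (2 * k + 1))
    have hr : ∀ k, r k * (1 - x ^ (2 * k + 1)) = 1 - x ^ (2 * k + 2) := fun k => by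
      have := inverse_one_sub_mul_pow hx 1 (2 * k)
      rw [one_mul] at this
      linear_combination (1 - x ^ (2 * k + 2)) * this
    have hrr : ∀ s ≤ n, ∏ k ∈ Finset.Ico s (n + 1), r k = (∏ k ∈ Finset.Ico s n, r k) * r n :=
      fun s hs => Finset.prod_Ico_succ_top hs r
    have hI := inverse_one_sub_mul_pow hx 1 (2 * n)
    rw [one_mul] at hI
    set I := Ring.inverse (1 - x ^ (2 * n + 1))
    have hrn : r n = (1 - x ^ (2 * n + 2)) * I := rfl
    set P : ℕ → R := fun s => ∏ k ∈ Finset.Ico s n, r k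
    have hP : ∀ s < n, P s * (1 - x ^ (2 * s + 1)) = P (s + 1) * (1 - x ^ (2 * s + 2)) :=
      fun s hs => by
        have h : P s = r s * P (s + 1) := Finset.prod_eq_prod_Ico_succ_bot hs r
        rw [h]
        linear_combination P (s + 1) * hr s
    have key := Finset.sum_range_sub
      (fun s => x ^ (s * (2 * n + 1)) * (1 - x ^ (2 * s)) * P s * I) n
    have hterm : ∀ s ∈ Finset.range n,
        x ^ (s * (2 * (n + 1) + 1)) * ∏ k ∈ Finset.Ico s (n + 1), r k -
          x ^ (s * (2 * n + 1)) * ∏ k ∈ Finset.Ico s n, r k =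
        x ^ ((s + 1) * (2 * n + 1)) * (1 - x ^ (2 * (s + 1))) * P (s + 1) * I -
          x ^ (s * (2 * n + 1)) * (1 - x ^ (2 * s)) * P s * I := fun s hs => by
      have hs' := Finset.mem_range.mp hs
      rw [hrr s hs'.le, hrn]
      change x ^ (s * (2 * (n + 1) + 1)) * (P s * ((1 - x ^ (2 * n + 2)) * I)) -
        x ^ (s * (2 * n + 1)) * P s = _
      linear_combination x ^ (s * (2 * n + 1)) * P s * hI
        + x ^ ((s + 1) * (2 * n + 1)) * I * hP s hs'
    rw [← Finset.sum_congr rfl hterm, Finset.sum_sub_distrib, ← ih] at key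
    have hn : P n = 1 := by simp [P]
    have e1 : 2 * n * (2 * n + 1) / 2 = n * (2 * n + 1) := by
      rw [mul_assoc, Nat.mul_div_cancel_left _ two_pos]
    have e2 : (2 * n + 1) * (2 * n + 1 + 1) / 2 = (2 * n + 1) * (n + 1) := by
      rw [show (2 * n + 1) * (2 * n + 1 + 1) = 2 * ((2 * n + 1) * (n + 1)) by ring,
        Nat.mul_div_cancel_left _ two_pos]
    rw [show 2 * (n + 1) = 2 * n + 1 + 1 by ring, Finset.sum_range_succ, Finset.sum_range_succ, e1,
      e2, Finset.sum_range_succ, hrr n le_rfl, hrn]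
    change _ = _ + x ^ (n * (2 * n + 1 + 1 + 1)) * (P n * ((1 - x ^ (2 * n + 2)) * I))
    rw [hn] at key ⊢
    simp only [zero_mul, mul_zero, pow_zero, sub_self] at key
    rw [show 2 * (n + 1) = 2 * n + 1 + 1 by ring] at key
    linear_combination -key - x ^ (n * (2 * n + 1)) * (1 + x ^ (2 * n + 1)) * hI

/-- The truncation of `ψ(x)` to its first `K` terms. -/
noncomputable def psiPartial (x : R) (K : ℕ) : R := ∑ m ∈ Finset.range K, x ^ (m * (m + 1) / 2)

theorem le_triangle (m : ℕ) : m ≤ m * (m + 1) / 2 := by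
  rw [Nat.le_div_iff_mul_le two_pos]
  rcases m.eq_zero_or_pos with rfl | h
  · simp
  · exact Nat.mul_le_mul_left m (by omega)

theorem psiPartial_mul_oddMinus (hx : x ^ K = 0) :
    psiPartial x K * oddMinus x K = eulerMinus (x ^ 2) K := by
  have h := shanks hx K
  have h1 : ∀ m, x ^ ((K + m) * (K + m + 1) / 2) = 0 := fun m =>
    pow_eq_zero_of_ge hx (le_trans (by omega) (le_triangle (K + m)))
  rw [two_mul, Finset.sum_range_add, Finset.sum_congr rfl fun m _ => h1 m,
    Finset.sum_const_zero, add_zero, ← psiPartial] at h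
  rw [h]
  rcases K with _ | K
  · exact (subsingleton_of_zero_eq_one (by simpa using hx.symm)).elim _ _
  rw [Finset.sum_range_succ', Finset.sum_eq_zero, zero_add, zero_mul, pow_zero, one_mul,
    ← Finset.range_eq_Ico, oddMinus, ← Finset.prod_mul_distrib, eulerMinus]
  · refine Finset.prod_congr rfl fun k _ => ?_
    have := inverse_one_sub_mul_pow hx 1 (2 * k)
    rw [one_mul] at this
    linear_combination (1 - x ^ (2 * k + 2)) * this
  · intro s _
    rw [pow_eq_zero_of_ge hx (show K + 1 ≤ (s + 1) * (K + 1 + (K + 1) + 1) by nlinarith), zero_mul]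

theorem mockThetaBSum_mul_psiPartial_sq (hx : x ^ K = 0) :
    (mockThetaBSum x K + mockThetaBSum (-x) K) * psiPartial (-x ^ 2) K ^ 2 =
      2 * psiPartial (x ^ 2) K ^ 2 * psiPartial ((x ^ 2) ^ 2) K := by
  have hB := mockThetaBSum_add_neg hx
  have hy := sq_pow_eq_zero hx
  have hy' : (-x ^ 2) ^ K = 0 := by rw [neg_pow, hy, mul_zero]
  generalize x ^ 2 = y at *
  have h1 := psiPartial_mul_oddMinus hy
  have h2 := psiPartial_mul_oddMinus hy'
  have h3 := psiPartial_mul_oddMinus (sq_pow_eq_zero hy)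
  rw [oddMinus_neg, neg_sq] at h2
  rw [← eulerMinus_mul_eulerPlus] at h3
  have h4 := eulerMinus_eq hy
  have h5 := eulerPlus_eq hy
  have h6 := eulerPlus_mul_oddMinus hy
  have h7 := eulerPlus_mul_oddMinus (sq_pow_eq_zero hy)
  rw [hB]
  refine ((isUnit_oddPlus hy K).pow 2).mul_right_cancel ?_
  set o := oddPlus y K
  set u := oddMinus y K
  set m := eulerPlus y K
  set p := eulerMinus y K
  set a := eulerMinus (y ^ 2) K
  set c := eulerPlus (y ^ 2) K
  set u' := oddMinus (y ^ 2) K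
  set A := psiPartial y K
  set B := psiPartial (-y) K
  set C := psiPartial (y ^ 2) K
  have hA : A = a * m := by linear_combination m * h1 - A * h6
  have hC : C = a * c ^ 2 := by linear_combination c * h3 - C * h7
  have hp : m * p = a := by linear_combination m * h4 + a * h6
  rw [hA, hC]
  linear_combination 2 * m ^ 5 * p * (B * o + a) * h2 + 2 * m ^ 4 * a ^ 2 * hp
    + 2 * a ^ 3 * m ^ 2 * (m + o * c) * h5

end Nilpotent

open PowerSeries

/-! ### Power series attached to weighted lattices -/

/-- The power series `∑ᵢ w(i) q^(e(i))` of a weight `w` and an exponent `e` on an index type. It has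
its meaning only when `e` has finite fibers; elsewhere the coefficients are junk values of `finsum`. -/
noncomputable def latticeSum {ι : Type*} (w : ι → ℤ) (e : ι → ℕ) : ℤ⟦X⟧ :=
  PowerSeries.mk fun n => ∑ᶠ i, if e i = n then w i else 0

section LatticeSum

variable {ι κ : Type*} {w : ι → ℤ} {e : ι → ℕ} {w' : κ → ℤ} {e' : κ → ℕ}

theorem coeff_latticeSum_eq_sum {n : ℕ} (s : Finset ι) (hs : ∀ i, e i = n → i ∈ s) :
    coeff n (latticeSum w e) = ∑ i ∈ s, if e i = n then w i else 0 := by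
  rw [latticeSum, coeff_mk]
  refine finsum_eq_sum_of_support_subset _ fun i hi => ?_
  by_contra h
  exact hi (if_neg fun h' => h (hs i h'))

/-- Reindexing. It needs no finiteness, since `finsum` is invariant under bijections. -/
theorem latticeSum_comp_bijective {f : κ → ι} (hf : Function.Bijective f) :
    latticeSum (fun i => w (f i)) (fun i => e (f i)) = latticeSum w e := by
  ext n
  rw [latticeSum, latticeSum, coeff_mk, coeff_mk]
  exact finsum_comp (g := fun i => if e i = n then w i else 0) f hf

theorem latticeSum_sum (he : ∀ n, {i | e i = n}.Finite) (he' : ∀ n, {i | e' i = n}.Finite) :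
    latticeSum (Sum.elim w w') (Sum.elim e e') = latticeSum w e + latticeSum w' e' := by
  ext n
  rw [map_add, coeff_latticeSum_eq_sum (he n).toFinset (by simp),
    coeff_latticeSum_eq_sum (he' n).toFinset (by simp),
    coeff_latticeSum_eq_sum ((he n).toFinset.disjSum (he' n).toFinset) (by simp),
    Finset.sum_disjSum]
  rfl

theorem latticeSum_mul (he : ∀ n, {i | e i = n}.Finite) (he' : ∀ n, {i | e' i = n}.Finite) :
    latticeSum w e * latticeSum w' e' =
      latticeSum (fun p : ι × κ => w p.1 * w' p.2) (fun p => e p.1 + e' p.2) := by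
  classical
  ext n
  set s := (Finset.range (n + 1)).biUnion fun a => (he a).toFinset with hs
  set t := (Finset.range (n + 1)).biUnion fun a => (he' a).toFinset with ht
  have hse : ∀ a ≤ n, ∀ i, e i = a → i ∈ s := fun a ha i hi => by
    rw [hs, Finset.mem_biUnion]
    exact ⟨a, Finset.mem_range.mpr (by omega), by simpa using hi⟩
  have hte : ∀ a ≤ n, ∀ i, e' i = a → i ∈ t := fun a ha i hi => by
    rw [ht, Finset.mem_biUnion]
    exact ⟨a, Finset.mem_range.mpr (by omega), by simpa using hi⟩
  rw [coeff_latticeSum_eq_sum (s ×ˢ t) fun p hp => Finset.mem_product.mpr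
    ⟨hse _ (by omega) p.1 rfl, hte _ (by omega) p.2 rfl⟩, coeff_mul, Finset.sum_product]
  have h1 : ∀ p ∈ Finset.HasAntidiagonal.antidiagonal n, coeff p.1 (latticeSum w e) * coeff p.2 (latticeSum w' e') =
      ∑ i ∈ s, ∑ j ∈ t, (if e i = p.1 then w i else 0) * if e' j = p.2 then w' j else 0 := by
    intro p hp
    rw [Finset.HasAntidiagonal.mem_antidiagonal] at hp
    rw [coeff_latticeSum_eq_sum s (hse _ (by omega)), coeff_latticeSum_eq_sum t (hte _ (by omega)),
      Finset.sum_mul_sum]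
  rw [Finset.sum_congr rfl h1, Finset.sum_comm]
  refine Finset.sum_congr rfl fun i _ => ?_
  rw [Finset.sum_comm]
  refine Finset.sum_congr rfl fun j _ => ?_
  split_ifs with h
  · rw [Finset.sum_eq_single (e i, e' j)]
    · simp
    · rintro ⟨a, b⟩ _ hab
      by_cases ha : e i = a
      · have hb : e' j ≠ b := fun hb => hab (by rw [ha, hb])
        simp [hb]
      · simp [ha]
    · simp [h]
  · refine Finset.sum_eq_zero fun p hp => ?_
    rw [Finset.HasAntidiagonal.mem_antidiagonal] at hp
    change ¬e i + e' j = n at h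
    by_cases ha : e i = p.1
    · rw [if_neg (show ¬ e' j = p.2 by omega), mul_zero]
    · rw [if_neg ha, zero_mul]

theorem latticeSum_smul (c : ℤ) (w : ι → ℤ) (he : ∀ n, {i | e i = n}.Finite) :
    latticeSum (fun i => c * w i) e = C c * latticeSum w e := by
  ext n
  rw [coeff_C_mul, coeff_latticeSum_eq_sum (he n).toFinset (by simp),
    coeff_latticeSum_eq_sum (he n).toFinset (by simp), Finset.mul_sum]
  simp

theorem latticeSum_add (w₁ w₂ : ι → ℤ) (he : ∀ n, {i | e i = n}.Finite) :
    latticeSum (fun i => w₁ i + w₂ i) e = latticeSum w₁ e + latticeSum w₂ e := by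
  ext n
  rw [map_add, coeff_latticeSum_eq_sum (he n).toFinset (by simp),
    coeff_latticeSum_eq_sum (he n).toFinset (by simp),
    coeff_latticeSum_eq_sum (he n).toFinset (by simp), ← Finset.sum_add_distrib]
  exact Finset.sum_congr rfl fun i _ => by split_ifs <;> simp

/-- A lattice sum vanishes if an involution preserves the exponent and negates the weight. -/
theorem latticeSum_eq_zero {f : ι → ι} (hf : Function.Involutive f)
    (he : ∀ n, {i | e i = n}.Finite) (hw : ∀ i, w (f i) = -w i) (hef : ∀ i, e (f i) = e i) :
    latticeSum w e = 0 := by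
  have h := latticeSum_comp_bijective (w := w) (e := e) hf.bijective
  have h2 := latticeSum_smul (-1) w he
  simp_rw [neg_one_mul] at h2
  simp_rw [hw, hef, h2, map_neg, map_one] at h
  ext n
  have := congrArg (coeff n) h
  rw [neg_one_mul, map_neg] at this
  rw [map_zero]
  omega

theorem latticeSum_expand (p : ℕ) (hp : p ≠ 0) (w : ι → ℤ) (e : ι → ℕ) :
    latticeSum w (fun i => p * e i) = expand p hp (latticeSum w e) := by
  ext n
  rw [coeff_expand]
  split_ifs with h
  · obtain ⟨m, rfl⟩ := h
    have h' : ∀ i, (p * e i = p * m) = (e i = m) := fun i => by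
      rw [Nat.mul_right_inj hp]
    rw [Nat.mul_div_cancel_left _ (Nat.pos_of_ne_zero hp), latticeSum, latticeSum, coeff_mk,
      coeff_mk]
    simp_rw [h']
  · rw [latticeSum, coeff_mk]
    refine finsum_eq_zero_of_forall_eq_zero fun i => if_neg ?_
    rintro rfl
    exact h (Dvd.intro _ rfl)

theorem latticeSum_add_const (c : ℕ) (w : ι → ℤ) (e : ι → ℕ) :
    latticeSum w (fun i => e i + c) = X ^ c * latticeSum w e := by
  ext n
  rw [coeff_X_pow_mul', latticeSum, coeff_mk]
  split_ifs with h
  · have h' : ∀ i, (e i + c = n) = (e i = n - c) := fun i => by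
      rw [eq_iff_iff]
      omega
    simp_rw [latticeSum, coeff_mk, h']
  · exact finsum_eq_zero_of_forall_eq_zero fun i => if_neg (by omega)

theorem finite_add_fibers (he : ∀ n, {i | e i = n}.Finite) (he' : ∀ n, {i | e' i = n}.Finite)
    (n : ℕ) : {p : ι × κ | e p.1 + e' p.2 = n}.Finite := by
  refine (((Finset.range (n + 1)).finite_toSet.biUnion fun a _ => he a).prod
    ((Finset.range (n + 1)).finite_toSet.biUnion fun a _ => he' a)).subset fun p hp => ?_
  simp only [Set.mem_ofPred_eq] at hp
  simp only [Set.mem_prod, Set.mem_iUnion, Finset.coe_range, Set.mem_Iio, Set.mem_ofPred_eq,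
    exists_prop, exists_eq_right']
  omega

theorem finite_fibers_comp (he : ∀ n, {i | e i = n}.Finite) {f : κ → ι}
    (hf : Function.Injective f) (n : ℕ) : {i | e (f i) = n}.Finite :=
  (he n).preimage hf.injOn

/-- Splitting a lattice sum along a partition of the index type into two parametrised classes. -/
theorem latticeSum_split {κ₁ κ₂ : Type*} (w : ι → ℤ) (he : ∀ n, {i | e i = n}.Finite)
    {f : κ₁ → ι} {g : κ₂ → ι} (h : Function.Bijective (Sum.elim f g)) :
    latticeSum w e = latticeSum (fun i => w (f i)) (fun i => e (f i)) +
      latticeSum (fun i => w (g i)) (fun i => e (g i)) := by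
  have hf : Function.Injective f := h.injective.comp Sum.inl_injective
  have hg : Function.Injective g := h.injective.comp Sum.inr_injective
  rw [← latticeSum_sum (finite_fibers_comp he hf) (finite_fibers_comp he hg),
    ← latticeSum_comp_bijective h]
  congr 1 <;> ext (i | i) <;> rfl

/-- Splitting a lattice sum along a partition of the index type into three parametrised classes. -/
theorem latticeSum_split₃ {κ₁ κ₂ κ₃ : Type*} (w : ι → ℤ) (he : ∀ n, {i | e i = n}.Finite)
    {f : κ₁ → ι} {g : κ₂ → ι} {k : κ₃ → ι}
    (h : Function.Bijective (Sum.elim f (Sum.elim g k))) :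
    latticeSum w e = latticeSum (fun i => w (f i)) (fun i => e (f i)) +
      latticeSum (fun i => w (g i)) (fun i => e (g i)) +
      latticeSum (fun i => w (k i)) (fun i => e (k i)) := by
  have hg : Function.Injective (Sum.elim g k) := h.injective.comp Sum.inr_injective
  have hk := latticeSum_sum (w := fun i => w (g i)) (w' := fun i => w (k i))
    (finite_fibers_comp he (hg.comp Sum.inl_injective))
    (finite_fibers_comp he (hg.comp Sum.inr_injective))
  rw [latticeSum_split w he h, add_assoc]
  refine congrArg _ (Eq.trans ?_ hk)
  congr 1 <;> ext (i | i) <;> rfl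

end LatticeSum

/-! ### Theta series -/

/-- The triangular number `k(k + 1)/2`, for integral `k`. -/
def triangle (k : ℤ) : ℕ := (k * (k + 1) / 2).toNat

/-- The generalised pentagonal number `k(3k + 1)/2`, for integral `k`. -/
def pentagon (k : ℤ) : ℕ := (k * (3 * k + 1) / 2).toNat

/-- The generalised octagonal number `k(3k + 2)`, for integral `k`. -/
def octagon (k : ℤ) : ℕ := (k * (3 * k + 2)).toNat

/-- The sign `(-1) ^ k` of an integer `k`, as an integer. -/
def signChar (k : ℤ) : ℤ := (k.negOnePow : ℤ)

theorem two_mul_triangle (k : ℤ) : 2 * (triangle k : ℤ) = k * (k + 1) := by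
  have h : 2 ∣ k * (k + 1) := (Int.even_mul_succ_self k).two_dvd
  have h0 : 0 ≤ k * (k + 1) := by
    rcases le_or_gt 0 k with hk | hk
    · positivity
    · nlinarith
  rw [triangle]
  omega

theorem two_mul_pentagon (k : ℤ) : 2 * (pentagon k : ℤ) = k * (3 * k + 1) := by
  have h : 2 ∣ k * (3 * k + 1) := by
    rw [show k * (3 * k + 1) = k * (k + 1) + 2 * (k * k) by ring]
    exact dvd_add (Int.even_mul_succ_self k).two_dvd (dvd_mul_right _ _)
  have h0 : 0 ≤ k * (3 * k + 1) := by
    rcases le_or_gt 0 k with hk | hk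
    · positivity
    · nlinarith
  rw [pentagon]
  omega

theorem cast_octagon (k : ℤ) : (octagon k : ℤ) = k * (3 * k + 2) := by
  have h0 : 0 ≤ k * (3 * k + 2) := by
    rcases le_or_gt 0 k with hk | hk
    · positivity
    · nlinarith
  rw [octagon]
  omega

theorem cast_natAbs_sq (k : ℤ) : ((k.natAbs ^ 2 : ℕ) : ℤ) = k ^ 2 := by
  rw [Nat.cast_pow, Int.natCast_natAbs, sq_abs]

theorem finite_fibers_of_sq_le {e : ℤ → ℕ} (c : ℕ) (h : ∀ k, k ^ 2 ≤ c * (e k : ℤ) + c) (n : ℕ) :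
    {k | e k = n}.Finite := by
  refine (Set.finite_Icc (-(c * n + c : ℤ)) (c * n + c)).subset fun k hk => ?_
  have hk' : e k = n := hk
  have h1 := h k
  rw [hk'] at h1
  rw [Set.mem_Icc]
  constructor
  · nlinarith [sq_nonneg (k + 1), sq_nonneg k]
  · nlinarith [sq_nonneg (k - 1), sq_nonneg k]

theorem finite_triangle : ∀ n, {k | triangle k = n}.Finite :=
  finite_fibers_of_sq_le 4 fun k => by
    have := two_mul_triangle k
    push_cast
    nlinarith [sq_nonneg (k + 1)]

theorem finite_pentagon : ∀ n, {k | pentagon k = n}.Finite :=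
  finite_fibers_of_sq_le 4 fun k => by
    have := two_mul_pentagon k
    push_cast
    nlinarith [sq_nonneg (k + 1)]

theorem finite_octagon : ∀ n, {k | octagon k = n}.Finite :=
  finite_fibers_of_sq_le 4 fun k => by
    have := cast_octagon k
    push_cast
    nlinarith [sq_nonneg (k + 1)]

theorem finite_square : ∀ n, {k : ℤ | k.natAbs ^ 2 = n}.Finite :=
  finite_fibers_of_sq_le 1 fun k => by
    have := cast_natAbs_sq k
    rw [this]
    push_cast
    linarith

theorem signChar_neg (k : ℤ) : signChar (-k) = signChar k := by rw [signChar, signChar, Int.negOnePow_neg]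

theorem signChar_eq_of_even {a b : ℤ} (h : Even (a - b)) : signChar a = signChar b := by
  rw [signChar, signChar, (Int.negOnePow_eq_iff a b).mpr h]

theorem signChar_eq_neg_of_odd {a b : ℤ} (h : Odd (a - b)) : signChar a = -signChar b := by
  obtain ⟨k, hk⟩ := h
  rw [show a = b + (2 * k + 1) by omega, signChar, signChar, Int.negOnePow_add,
    Int.negOnePow_two_mul_add_one, mul_neg, mul_one, Units.val_neg]

/-- `ψ(q) = ∑_{m ≥ 0} q^(m(m+1)/2)`. -/
noncomputable def thetaPsi : ℤ⟦X⟧ := latticeSum (fun _ : ℕ => 1) fun m => m * (m + 1) / 2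

/-- `φ(q) = ∑_{k ∈ ℤ} q^(k²)`. -/
noncomputable def thetaPhi : ℤ⟦X⟧ := latticeSum (fun _ : ℤ => 1) fun k => k.natAbs ^ 2

/-- `φ(-q) = ∑_{k ∈ ℤ} (-1)^k q^(k²)`. -/
noncomputable def thetaPhiNeg : ℤ⟦X⟧ := latticeSum signChar fun k => k.natAbs ^ 2

/-- `∑_{k ∈ ℤ} q^(k(3k+1)/2)`, Ramanujan's `f(q, q²)`. -/
noncomputable def thetaPent : ℤ⟦X⟧ := latticeSum (fun _ : ℤ => 1) pentagon

/-- `∑_{k ∈ ℤ} (-1)^k q^(k(3k+2))`, Ramanujan's `f(-q, -q⁵)`. -/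
noncomputable def thetaOct : ℤ⟦X⟧ := latticeSum signChar octagon

theorem triangle_natCast (m : ℕ) : triangle m = m * (m + 1) / 2 := by
  rw [triangle]
  norm_cast

theorem finite_triangle_nat : ∀ n, {m : ℕ | m * (m + 1) / 2 = n}.Finite := fun n => by
  have := finite_fibers_comp finite_triangle (f := ((↑) : ℕ → ℤ)) Nat.cast_injective n
  simpa only [triangle_natCast] using this

theorem triangle_neg (k : ℤ) : triangle (-1 - k) = triangle k := by
  have h1 := two_mul_triangle k
  have h2 := two_mul_triangle (-1 - k)
  have : 2 * (triangle (-1 - k) : ℤ) = 2 * triangle k := by rw [h1, h2]; ring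
  omega

theorem two_ne_zero_powerSeries : (2 : ℤ⟦X⟧) ≠ 0 := fun h => by
  have h' := congrArg constantCoeff h
  rw [map_ofNat, map_zero] at h'
  norm_num at h'

/-- Every triangular number has exactly two representations `k(k + 1)/2` with `k ∈ ℤ`. -/
theorem latticeSum_triangle : latticeSum (fun _ : ℤ => 1) triangle = 2 * thetaPsi := by
  have hf : Function.Bijective
      (Sum.elim (fun m : ℕ => (m : ℤ)) (fun m : ℕ => -1 - (m : ℤ))) := by
    constructor
    · rintro (a | a) (b | b) h <;> simp at h ⊢ <;> omega
    · intro k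
      rcases le_or_gt 0 k with hk | hk
      · exact ⟨Sum.inl k.toNat, by simp; omega⟩
      · exact ⟨Sum.inr (-1 - k).toNat, by simp; omega⟩
  rw [← latticeSum_comp_bijective hf, two_mul, thetaPsi,
    ← latticeSum_sum finite_triangle_nat finite_triangle_nat]
  congr 1
  · ext (a | a) <;> rfl
  · ext (a | a)
    · exact triangle_natCast a
    · exact (triangle_neg a).trans (triangle_natCast a)

/-- `ψ(q)² = ψ(q²) φ(q)`. On pairs `(m, n) ∈ ℤ²` with `m + n` even this is the rotation
`(m, n) = (a + b, a - b)`, and the reflection `n ↦ -1 - n` exchanges the two parities of `m + n`. -/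
theorem thetaPsi_sq : thetaPsi ^ 2 = expand 2 two_ne_zero thetaPsi * thetaPhi := by
  have hf : Function.Bijective
      (Sum.elim (fun p : ℤ × ℤ => (p.1 + p.2, p.1 - p.2))
        (fun p : ℤ × ℤ => (p.1 + p.2, -1 - (p.1 - p.2)))) := by
    constructor
    · rintro (⟨a, b⟩ | ⟨a, b⟩) (⟨c, d⟩ | ⟨c, d⟩) h <;> simp at h ⊢ <;> omega
    · rintro ⟨m, n⟩
      rcases Int.emod_two_eq_zero_or_one (m + n) with h | h
      · exact ⟨Sum.inl ((m + n) / 2, (m - n) / 2), by simp; omega⟩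
      · exact ⟨Sum.inr ((m - n - 1) / 2, (m + n + 1) / 2), by simp; omega⟩
  have hfin : ∀ n, {k : ℤ | 2 * triangle k = n}.Finite := fun n =>
    (finite_triangle (n / 2)).subset fun k hk => by
      simp only [Set.mem_ofPred_eq] at hk ⊢
      omega
  have h1 : latticeSum (fun _ : ℤ × ℤ => 1) (fun p => 2 * triangle p.1 + p.2.natAbs ^ 2) =
      expand 2 two_ne_zero (2 * thetaPsi) * thetaPhi := by
    rw [← latticeSum_triangle, ← latticeSum_expand, thetaPhi, latticeSum_mul hfin finite_square]
    simp
  have h2 : latticeSum (fun _ : ℤ × ℤ => 1) (fun p => triangle p.1 + triangle p.2) =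
      (2 * thetaPsi) * (2 * thetaPsi) := by
    rw [← latticeSum_triangle, latticeSum_mul finite_triangle finite_triangle]
    simp
  have h3 : ∀ a b : ℤ, triangle (a + b) + triangle (a - b) = 2 * triangle a + b.natAbs ^ 2 := by
    intro a b
    have e1 := two_mul_triangle (a + b)
    have e2 := two_mul_triangle (a - b)
    have e3 := two_mul_triangle a
    have e4 := cast_natAbs_sq b
    have : 2 * ((triangle (a + b) + triangle (a - b) : ℕ) : ℤ) =
        2 * ((2 * triangle a + b.natAbs ^ 2 : ℕ) : ℤ) := by
      push_cast at e4 ⊢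
      linear_combination e1 + e2 - 2 * e3 - 2 * e4
    omega
  have h4 := latticeSum_split (fun _ => 1) (finite_add_fibers finite_triangle finite_triangle) hf
  simp_rw [triangle_neg, h3] at h4
  rw [h1, h2, map_mul, map_ofNat] at h4
  refine mul_left_cancel₀ (mul_ne_zero two_ne_zero_powerSeries two_ne_zero_powerSeries) ?_
  linear_combination h4

/-! ### Dissections modulo three -/

/-- `ψ(q) = A(q³) + q ψ(q⁹)` with `A = f(q, q²)`. -/
theorem thetaPsi_split : thetaPsi =
    expand 3 three_ne_zero thetaPent + X * expand 3 three_ne_zero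
      (expand 3 three_ne_zero thetaPsi) := by
  have hf : Function.Bijective (Sum.elim (fun k : ℤ => 3 * k) (Sum.elim (fun k : ℤ => 3 * k + 1)
      (fun k : ℤ => -1 - 3 * k))) := by
    constructor
    · rintro (a | a | a) (b | b | b) h <;> simp at h ⊢ <;> omega
    · intro k
      rcases (show k % 3 = 0 ∨ k % 3 = 1 ∨ k % 3 = 2 by omega) with h | h | h
      · exact ⟨Sum.inl (k / 3), by simp; omega⟩
      · exact ⟨Sum.inr (Sum.inl (k / 3)), by simp; omega⟩
      · exact ⟨Sum.inr (Sum.inr (-1 - k / 3)), by simp; omega⟩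
  have h := latticeSum_split₃ (fun _ => 1) finite_triangle hf
  have h0 : ∀ k, triangle (3 * k) = 3 * pentagon k := fun k => by
    have e1 := two_mul_triangle (3 * k)
    have e2 := two_mul_pentagon k
    have : 2 * (triangle (3 * k) : ℤ) = 2 * ((3 * pentagon k : ℕ) : ℤ) := by
      push_cast
      linear_combination e1 - 3 * e2
    omega
  have h1 : ∀ k, triangle (3 * k + 1) = 3 * (3 * triangle k) + 1 := fun k => by
    have e1 := two_mul_triangle (3 * k + 1)
    have e2 := two_mul_triangle k
    have : 2 * (triangle (3 * k + 1) : ℤ) = 2 * ((3 * (3 * triangle k) + 1 : ℕ) : ℤ) := by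
      push_cast
      linear_combination e1 - 9 * e2
    omega
  simp_rw [triangle_neg, h0, h1] at h
  rw [latticeSum_add_const, latticeSum_expand 3 three_ne_zero, latticeSum_expand 3 three_ne_zero,
    latticeSum_expand 3 three_ne_zero, latticeSum_triangle, ← thetaPent, map_mul, map_mul,
    map_ofNat, map_ofNat, pow_one] at h
  refine mul_left_cancel₀ two_ne_zero_powerSeries ?_
  linear_combination h

/-- `φ(-q) = φ(-q⁹) - 2q Ω(q³)` with `Ω = f(-q, -q⁵)`. -/
theorem thetaPhiNeg_split : thetaPhiNeg =
    expand 3 three_ne_zero (expand 3 three_ne_zero thetaPhiNeg) -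
      2 * X * expand 3 three_ne_zero thetaOct := by
  have hf : Function.Bijective (Sum.elim (fun k : ℤ => 3 * k) (Sum.elim (fun k : ℤ => 3 * k + 1)
      (fun k : ℤ => -(3 * k + 1)))) := by
    constructor
    · rintro (a | a | a) (b | b | b) h <;> simp at h ⊢ <;> omega
    · intro k
      rcases (show k % 3 = 0 ∨ k % 3 = 1 ∨ k % 3 = 2 by omega) with h | h | h
      · exact ⟨Sum.inl (k / 3), by simp; omega⟩
      · exact ⟨Sum.inr (Sum.inl (k / 3)), by simp; omega⟩
      · exact ⟨Sum.inr (Sum.inr (-1 - k / 3)), by simp; omega⟩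
  have h := latticeSum_split₃ signChar finite_square hf
  have h0 : ∀ k : ℤ, (3 * k).natAbs ^ 2 = 3 * (3 * k.natAbs ^ 2) := fun k => by
    rw [Int.natAbs_mul]
    simp
    ring
  have h1 : ∀ k : ℤ, (3 * k + 1).natAbs ^ 2 = 3 * octagon k + 1 := fun k => by
    have e1 := cast_natAbs_sq (3 * k + 1)
    have e2 := cast_octagon k
    have : (((3 * k + 1).natAbs ^ 2 : ℕ) : ℤ) = ((3 * octagon k + 1 : ℕ) : ℤ) := by
      rw [e1]
      push_cast
      linear_combination -3 * e2
    exact_mod_cast this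
  have s0 : ∀ k : ℤ, signChar (3 * k) = signChar k := fun k =>
    signChar_eq_of_even ⟨k, by ring⟩
  have s1 : ∀ k : ℤ, signChar (3 * k + 1) = -1 * signChar k := fun k => by
    rw [neg_one_mul]
    exact signChar_eq_neg_of_odd ⟨k, by ring⟩
  simp_rw [signChar_neg, Int.natAbs_neg, h0, h1, s0, s1] at h
  have hfin : ∀ n, {k : ℤ | 3 * octagon k + 1 = n}.Finite := fun n =>
    (finite_octagon ((n - 1) / 3)).subset fun k hk => by
      simp only [Set.mem_ofPred_eq] at hk ⊢
      omega
  rw [latticeSum_smul _ _ hfin, latticeSum_add_const, latticeSum_expand 3 three_ne_zero,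
    latticeSum_expand 3 three_ne_zero,
    latticeSum_expand 3 three_ne_zero, ← thetaPhiNeg, ← thetaOct, pow_one, map_neg, map_one] at h
  linear_combination h

/-- `f(q, q²) f(-q, -q⁵) = ψ(q³) φ(-q³)`. With `x = 6k + 1` and `y = 3l + 1` the left side is a sum
over elements `x + 2y√-2` of `ℤ[√-2]`, all divisible by `π = 1 - √-2`; with `x = 2m + 1` and `y = n`
twice the right side is a sum over all `x + 2y√-2` with `x` odd. Conjugating the cofactor of a prime
above `3` negates the weight, so on the left only multiples of `π²`, and on the right only elements
prime to `1 + √-2`, survive. Multiplication by `π²` matches these, up to the sign `±1`. -/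
theorem thetaPent_mul_thetaOct : thetaPent * thetaOct =
    expand 3 three_ne_zero thetaPsi * expand 3 three_ne_zero thetaPhiNeg := by
  -- the right-hand side, doubled and split by `n - m` modulo `3`
  have hf : Function.Bijective (Sum.elim (fun p : ℤ × ℤ => (p.2, p.2 + 3 * p.1 + 1))
      (Sum.elim (fun p : ℤ × ℤ => (-1 - p.2, -(p.2 + 3 * p.1 + 1)))
        (fun p : ℤ × ℤ => (p.2, p.2 + 3 * p.1 + 2)))) := by
    constructor
    · rintro (⟨a, b⟩ | ⟨a, b⟩ | ⟨a, b⟩) (⟨c, d⟩ | ⟨c, d⟩ | ⟨c, d⟩) h <;> simp at h ⊢ <;> omega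
    · rintro ⟨m, n⟩
      rcases (show (n - m) % 3 = 0 ∨ (n - m) % 3 = 1 ∨ (n - m) % 3 = 2 by omega) with h | h | h
      · exact ⟨Sum.inr (Sum.inl (-(n - m) / 3, -1 - m)), by simp; omega⟩
      · exact ⟨Sum.inl ((n - m) / 3, m), by simp; omega⟩
      · exact ⟨Sum.inr (Sum.inr ((n - m) / 3, m)), by simp; omega⟩
  have hg : Function.Bijective (Sum.elim (fun p : ℤ × ℤ => (3 * p.1 - p.2, p.2))
      (Sum.elim (fun p : ℤ × ℤ => (3 * p.1 + 1 - p.2, p.2))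
        (fun p : ℤ × ℤ => (3 * p.1 + 2 - p.2, p.2)))) := by
    constructor
    · rintro (⟨a, b⟩ | ⟨a, b⟩ | ⟨a, b⟩) (⟨c, d⟩ | ⟨c, d⟩ | ⟨c, d⟩) h <;> simp at h ⊢ <;> omega
    · rintro ⟨k, l⟩
      rcases (show (k + l) % 3 = 0 ∨ (k + l) % 3 = 1 ∨ (k + l) % 3 = 2 by omega) with h | h | h
      · exact ⟨Sum.inl ((k + l) / 3, l), by simp; omega⟩
      · exact ⟨Sum.inr (Sum.inl ((k + l) / 3, l)), by simp; omega⟩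
      · exact ⟨Sum.inr (Sum.inr ((k + l) / 3, l)), by simp; omega⟩
  have fin3 : ∀ {e : ℤ → ℕ}, (∀ n, {k | e k = n}.Finite) → ∀ n, {k | 3 * e k = n}.Finite :=
    fun he n => (he (n / 3)).subset fun k hk => by
      simp only [Set.mem_ofPred_eq] at hk ⊢
      omega
  have finR := finite_add_fibers (fin3 finite_triangle) (fin3 finite_square)
  have finL := finite_add_fibers finite_pentagon finite_octagon
  have hR := latticeSum_split₃ (fun p => signChar p.2) finR hf
  have hL := latticeSum_split₃ (fun p => signChar p.2) finL hg
  -- the class `n - m ≡ 2` on the right-hand side cancels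
  have hR0 : latticeSum (fun p : ℤ × ℤ => signChar (p.2 + 3 * p.1 + 2))
      (fun p => 3 * triangle p.2 + 3 * (p.2 + 3 * p.1 + 2).natAbs ^ 2) = 0 := by
    refine latticeSum_eq_zero (f := fun p => (-p.1 - 1, p.2 + 4 * p.1 + 2)) ?_
      (finite_fibers_comp finR (hf.injective.comp
        (Sum.inr_injective.comp Sum.inr_injective))) ?_ ?_
    · rintro ⟨s, m⟩
      simp
      ring
    · rintro ⟨s, m⟩
      exact signChar_eq_neg_of_odd ⟨-s - 1, by ring⟩
    · rintro ⟨s, m⟩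
      have e1 := two_mul_triangle m
      have e2 := two_mul_triangle (m + 4 * s + 2)
      have e3 := cast_natAbs_sq (m + 3 * s + 2)
      have e4 := cast_natAbs_sq (m + 4 * s + 2 + 3 * (-s - 1) + 2)
      have : 2 * ((3 * triangle (m + 4 * s + 2) +
          3 * (m + 4 * s + 2 + 3 * (-s - 1) + 2).natAbs ^ 2 : ℕ) : ℤ) =
          2 * ((3 * triangle m + 3 * (m + 3 * s + 2).natAbs ^ 2 : ℕ) : ℤ) := by
        push_cast at e3 e4 ⊢
        linear_combination 3 * e2 - 3 * e1 + 6 * e4 - 6 * e3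
      simp only
      omega
  -- the classes `k + l ≡ 1` and `k + l ≡ 2` on the left-hand side cancel
  have hL1 : latticeSum (fun p : ℤ × ℤ => signChar p.2)
      (fun p => pentagon (3 * p.1 + 1 - p.2) + octagon p.2) = 0 := by
    refine latticeSum_eq_zero (f := fun p => (-p.1 - 1, p.2 - 2 * p.1 - 1)) ?_
      (finite_fibers_comp finL (hg.injective.comp
        (Sum.inr_injective.comp Sum.inl_injective))) ?_ ?_
    · rintro ⟨s, l⟩
      simp
      ring
    · rintro ⟨s, l⟩
      exact signChar_eq_neg_of_odd ⟨-s - 1, by ring⟩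
    · rintro ⟨s, l⟩
      have e1 := two_mul_pentagon (3 * s + 1 - l)
      have e2 := two_mul_pentagon (3 * (-s - 1) + 1 - (l - 2 * s - 1))
      have e3 := cast_octagon l
      have e4 := cast_octagon (l - 2 * s - 1)
      have : 2 * ((pentagon (3 * (-s - 1) + 1 - (l - 2 * s - 1)) + octagon (l - 2 * s - 1) : ℕ) : ℤ)
          = 2 * ((pentagon (3 * s + 1 - l) + octagon l : ℕ) : ℤ) := by
        push_cast
        linear_combination e2 - e1 + 2 * e4 - 2 * e3
      simp only
      omega
  have hL2 : latticeSum (fun p : ℤ × ℤ => signChar p.2)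
      (fun p => pentagon (3 * p.1 + 2 - p.2) + octagon p.2) = 0 := by
    refine latticeSum_eq_zero (f := fun p => (p.1, 2 * p.1 + 1 - p.2)) ?_
      (finite_fibers_comp finL (hg.injective.comp
        (Sum.inr_injective.comp Sum.inr_injective))) ?_ ?_
    · rintro ⟨s, l⟩
      simp
    · rintro ⟨s, l⟩
      exact signChar_eq_neg_of_odd ⟨s - l, by ring⟩
    · rintro ⟨s, l⟩
      have e1 := two_mul_pentagon (3 * s + 2 - l)
      have e2 := two_mul_pentagon (3 * s + 2 - (2 * s + 1 - l))
      have e3 := cast_octagon l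
      have e4 := cast_octagon (2 * s + 1 - l)
      have : 2 * ((pentagon (3 * s + 2 - (2 * s + 1 - l)) + octagon (2 * s + 1 - l) : ℕ) : ℤ)
          = 2 * ((pentagon (3 * s + 2 - l) + octagon l : ℕ) : ℤ) := by
        push_cast
        linear_combination e2 - e1 + 2 * e4 - 2 * e3
      simp only
      omega
  -- the class `k + l ≡ 0` on the left corresponds to `n - m ≡ 1` on the right, which the reflection
  -- `(m, n) ↦ (-1 - m, -n)` exchanges with `n - m ≡ 0`
  have hLR : latticeSum (fun p : ℤ × ℤ => signChar p.2)
      (fun p => pentagon (3 * p.1 - p.2) + octagon p.2) =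
      latticeSum (fun p : ℤ × ℤ => signChar (p.2 + 3 * p.1 + 1))
      (fun p => 3 * triangle p.2 + 3 * (p.2 + 3 * p.1 + 1).natAbs ^ 2) := by
    have hb : Function.Bijective (fun p : ℤ × ℤ => (p.1, -p.2 - p.1 - 1)) := by
      refine Function.Involutive.bijective ?_
      rintro ⟨s, m⟩
      simp
      ring
    rw [← latticeSum_comp_bijective hb]
    congr 1
    · ext ⟨s, m⟩
      exact signChar_eq_of_even ⟨-m - 2 * s - 1, by ring⟩
    · ext ⟨s, m⟩
      have e1 := two_mul_pentagon (3 * s - (-m - s - 1))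
      have e2 := cast_octagon (-m - s - 1)
      have e3 := two_mul_triangle m
      have e4 := cast_natAbs_sq (m + 3 * s + 1)
      have : 2 * ((pentagon (3 * s - (-m - s - 1)) + octagon (-m - s - 1) : ℕ) : ℤ) =
          2 * ((3 * triangle m + 3 * (m + 3 * s + 1).natAbs ^ 2 : ℕ) : ℤ) := by
        push_cast at e4 ⊢
        linear_combination e1 + 2 * e2 - 3 * e3 - 6 * e4
      simp only
      omega
  have h1 : latticeSum (fun p : ℤ × ℤ => signChar p.2)
      (fun p => pentagon p.1 + octagon p.2) = thetaPent * thetaOct := by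
    rw [thetaPent, thetaOct, latticeSum_mul finite_pentagon finite_octagon]
    simp_rw [one_mul]
  have h2 : latticeSum (fun p : ℤ × ℤ => signChar p.2)
      (fun p => 3 * triangle p.1 + 3 * p.2.natAbs ^ 2) =
      2 * (expand 3 three_ne_zero thetaPsi * expand 3 three_ne_zero thetaPhiNeg) := by
    rw [← mul_assoc, ← map_ofNat (expand (R := ℤ) 3 three_ne_zero) 2, ← map_mul,
      ← latticeSum_triangle, thetaPhiNeg, ← latticeSum_expand, ← latticeSum_expand,
      latticeSum_mul (fin3 finite_triangle) (fin3 finite_square)]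
    simp_rw [one_mul]
  simp_rw [triangle_neg, signChar_neg, Int.natAbs_neg] at hR
  rw [h1, hL1, hL2] at hL
  rw [h2, hR0] at hR
  refine mul_left_cancel₀ two_ne_zero_powerSeries ?_
  linear_combination 2 * hL - hR + 2 * hLR

/-! ### Theta series at `-q` and modulo four -/

theorem coeff_evalNegHom (n : ℕ) (f : ℤ⟦X⟧) : coeff n (evalNegHom f) = (-1) ^ n * coeff n f := by
  rw [evalNegHom, coeff_rescale]

theorem evalNegHom_expand_two (f : ℤ⟦X⟧) :
    evalNegHom (expand 2 two_ne_zero f) = expand 2 two_ne_zero f := by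
  ext n
  rw [coeff_evalNegHom, coeff_expand]
  split_ifs with h
  · rw [(even_iff_two_dvd.mpr h).neg_one_pow, one_mul]
  · rw [mul_zero]

theorem evalNegHom_thetaPhi : evalNegHom thetaPhi = thetaPhiNeg := by
  ext n
  rw [coeff_evalNegHom, thetaPhi, thetaPhiNeg,
    coeff_latticeSum_eq_sum (finite_square n).toFinset (by simp),
    coeff_latticeSum_eq_sum (finite_square n).toFinset (by simp), Finset.mul_sum]
  refine Finset.sum_congr rfl fun k _ => ?_
  split_ifs with h
  · rw [← h, mul_one]
    rcases Nat.even_or_odd k.natAbs with hk | hk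
    · rw [(hk.pow_of_ne_zero two_ne_zero).neg_one_pow, signChar,
        Int.negOnePow_even _ (Int.natAbs_even.mp hk), Units.val_one]
    · rw [hk.pow.neg_one_pow, signChar, Int.negOnePow_odd _ (Int.natAbs_odd.mp hk), Units.val_neg,
        Units.val_one]
  · simp

theorem evalNegHom_thetaPsi_sq :
    evalNegHom thetaPsi ^ 2 = expand 2 two_ne_zero thetaPsi * thetaPhiNeg := by
  rw [← map_pow, thetaPsi_sq, map_mul, evalNegHom_expand_two, evalNegHom_thetaPhi]

theorem latticeSum_square_eq (w : ℤ → ℤ) (h0 : w 0 = 1) (hw : ∀ k, w (-k) = w k) :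
    latticeSum w (fun k => k.natAbs ^ 2) =
      1 + 2 * latticeSum (fun k : ℕ => w (k + 1)) (fun k => (k + 1) ^ 2) := by
  have hf : Function.Bijective (Sum.elim (fun _ : Unit => (0 : ℤ))
      (Sum.elim (fun k : ℕ => ((k + 1 : ℕ) : ℤ)) (fun k : ℕ => -((k + 1 : ℕ) : ℤ)))) := by
    constructor
    · rintro (a | a | a) (b | b | b) h <;> simp at h ⊢ <;> omega
    · intro k
      rcases lt_trichotomy k 0 with h | h | h
      · exact ⟨Sum.inr (Sum.inr (-k - 1).toNat), by simp; omega⟩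
      · exact ⟨Sum.inl (), by simp; omega⟩
      · exact ⟨Sum.inr (Sum.inl (k - 1).toNat), by simp; omega⟩
  have h := latticeSum_split₃ w finite_square hf
  have h1 : latticeSum (fun _ : Unit => w 0) (fun _ => (0 : ℤ).natAbs ^ 2) = 1 := by
    ext n
    rw [coeff_latticeSum_eq_sum Finset.univ (by simp), coeff_one]
    simp [h0, eq_comm]
  rw [h1] at h
  simp_rw [Int.natAbs_neg, hw, Int.natAbs_natCast, Nat.cast_succ] at h
  rw [h]
  ring

/-- `φ(q) φ(-q) ≡ 1` modulo `4`. -/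
theorem thetaPhi_mul_thetaPhiNeg : ∃ g, thetaPhi * thetaPhiNeg = 1 + 4 * g := by
  have hfin : ∀ n, {k : ℕ | (k + 1) ^ 2 = n}.Finite := fun n =>
    (Set.finite_Iic n).subset fun k (hk : (k + 1) ^ 2 = n) => by
      rw [Set.mem_Iic]
      nlinarith
  have h1 := latticeSum_square_eq (fun _ => 1) rfl fun _ => rfl
  have h2 := latticeSum_square_eq signChar rfl signChar_neg
  have h3 := latticeSum_add (fun k : ℕ => 1) (fun k : ℕ => signChar (k + 1)) hfin
  have h4 : (fun k : ℕ => 1 + signChar (k + 1)) =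
      fun k : ℕ => 2 * (if Odd k then 1 else 0 : ℤ) := by
    ext k
    split_ifs with hk
    · rw [signChar, Int.negOnePow_even _ (by exact_mod_cast hk.add_one)]
      norm_num
    · rw [signChar, Int.negOnePow_odd _ (by exact_mod_cast (Nat.not_odd_iff_even.mp hk).add_one)]
      norm_num
  rw [h4, latticeSum_smul _ _ hfin] at h3
  rw [thetaPhi, thetaPhiNeg, h1, h2]
  set s := latticeSum (fun k : ℕ => (1 : ℤ)) (fun k => (k + 1) ^ 2)
  set t := latticeSum (fun k : ℕ => signChar (k + 1)) (fun k => (k + 1) ^ 2)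
  rw [map_ofNat] at h3
  exact ⟨latticeSum (fun k : ℕ => if Odd k then 1 else 0) (fun k => (k + 1) ^ 2) + s * t, by
    linear_combination -2 * h3⟩

/-- `φ(-q)² ≡ 1` modulo `4`. -/
theorem thetaPhiNeg_sq : ∃ g, thetaPhiNeg ^ 2 = 1 + 4 * g := by
  have h2 := latticeSum_square_eq signChar rfl signChar_neg
  set t := latticeSum (fun k : ℕ => signChar (k + 1)) (fun k => (k + 1) ^ 2)
  exact ⟨t + t ^ 2, by rw [thetaPhiNeg, h2]; ring⟩

/-! ### The generating function of `b(2n)` -/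

/-- The series `ℬ(q)`. -/
noncomputable def mockThetaB : ℤ⟦X⟧ := PowerSeries.mk mockThetaBCoeff

/-- `∑ b(2n) qⁿ`, so that its value at `q²` is the even part of `ℬ(q)`. -/
noncomputable def mockThetaBEven : ℤ⟦X⟧ := PowerSeries.mk fun n => mockThetaBCoeff (2 * n)

theorem mockThetaB_add_neg :
    mockThetaB + evalNegHom mockThetaB = 2 * expand 2 two_ne_zero mockThetaBEven := by
  ext n
  rw [map_add, coeff_evalNegHom, ← map_ofNat (C (R := ℤ)) 2, coeff_C_mul, coeff_expand, mockThetaB,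
    coeff_mk]
  split_ifs with h
  · rw [mockThetaBEven, coeff_mk, Nat.mul_div_cancel' h, (even_iff_two_dvd.mpr h).neg_one_pow]
    ring
  · rw [(Nat.not_even_iff_odd.mp fun h' => h (even_iff_two_dvd.mp h')).neg_one_pow]
    ring

section Hom

variable {R : Type*} [CommRing R] (θ : ℤ⟦X⟧ →+* R) {K : ℕ}

theorem map_mockThetaBTerm (hθ : θ X ^ K = 0) (n : ℕ) :
    θ (mockThetaBTerm n) = θ X ^ n * (∏ j ∈ Finset.range n, (1 + θ X ^ (2 * j + 1))) *
      ∏ j ∈ Finset.range (n + 1), Ring.inverse (1 - θ X ^ (2 * j + 1)) := by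
  have h := congrArg θ (mockThetaBTerm_mul n)
  have h1 : ∀ j, θ X * (θ X ^ 2) ^ j = θ X ^ (2 * j + 1) := fun j => by ring
  simp only [qPoch, map_mul, map_prod, map_sub, map_add, map_one, map_pow, neg_mul, sub_neg_eq_add,
    h1] at h
  have h2 : (∏ j ∈ Finset.range (n + 1), (1 - θ X ^ (2 * j + 1))) *
      ∏ j ∈ Finset.range (n + 1), Ring.inverse (1 - θ X ^ (2 * j + 1)) = 1 := by
    rw [← Finset.prod_mul_distrib]
    refine Finset.prod_eq_one fun j _ => ?_
    simpa using inverse_one_sub_mul_pow hθ 1 (2 * j)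
  rw [← h, mul_assoc, h2, mul_one]

theorem map_eq_of_coeff_eq (hθ : θ X ^ K = 0) {f g : ℤ⟦X⟧}
    (h : ∀ n < K, coeff n f = coeff n g) : θ f = θ g := by
  have h1 : X ^ K ∣ f - g := X_pow_dvd_iff.mpr fun n hn => by rw [map_sub, h n hn, sub_self]
  obtain ⟨u, hu⟩ := h1
  rw [← sub_eq_zero, ← map_sub, hu, map_mul, map_pow, hθ, zero_mul]

theorem map_mockThetaB (hθ : θ X ^ K = 0) : θ mockThetaB = mockThetaBSum (θ X) K := by
  rw [mockThetaBSum, ← Finset.sum_congr rfl fun n _ => map_mockThetaBTerm θ hθ n, ← map_sum]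
  refine map_eq_of_coeff_eq θ hθ fun n hn => ?_
  rw [mockThetaB, coeff_mk, mockThetaBCoeff, map_sum]
  refine Finset.sum_subset (Finset.range_subset_range.mpr hn) fun m _ hm => ?_
  exact coeff_mockThetaBTerm_of_lt (by simpa using hm)

theorem map_thetaPsi (hθ : θ X ^ K = 0) : θ thetaPsi = psiPartial (θ X) K := by
  rw [psiPartial]
  simp_rw [← map_pow, ← map_sum]
  refine map_eq_of_coeff_eq θ hθ fun n hn => ?_
  rw [thetaPsi, coeff_latticeSum_eq_sum (Finset.range K), map_sum]
  · refine Finset.sum_congr rfl fun m _ => ?_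
    rw [coeff_X_pow]
    simp only [eq_comm]
  · intro m hm
    have := le_triangle m
    rw [Finset.mem_range]
    omega

/-- `(ℬ(q) + ℬ(-q)) ψ(-q²)² = 2 ψ(q²)² ψ(q⁴)`, under any ring homomorphism that makes `q` nilpotent. -/
theorem map_mockThetaB_mul_thetaPsi_sq (hθ : θ X ^ K = 0) :
    θ ((mockThetaB + evalNegHom mockThetaB) *
      expand 2 two_ne_zero (evalNegHom thetaPsi) ^ 2) = θ (2 * expand 2 two_ne_zero thetaPsi ^ 2 *
        expand 2 two_ne_zero (expand 2 two_ne_zero thetaPsi)) := by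
  have hx' : (-θ X) ^ K = 0 := by rw [neg_pow, hθ, mul_zero]
  have hy := sq_pow_eq_zero hθ
  have hy' : (-θ X ^ 2) ^ K = 0 := by rw [neg_pow, hy, mul_zero]
  obtain ⟨ε, hε⟩ : ∃ ε : ℤ⟦X⟧ →+* ℤ⟦X⟧, ∀ f, ε f = expand 2 two_ne_zero f :=
    ⟨(expand 2 two_ne_zero : ℤ⟦X⟧ →ₐ[ℤ] ℤ⟦X⟧).toRingHom, fun _ => rfl⟩
  have hX : ε X = X ^ 2 := (hε X).trans (expand_X 2 two_ne_zero)
  have e1 := map_mockThetaB θ hθ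
  have e2 := map_mockThetaB (θ.comp evalNegHom) (K := K) (by simpa using hx')
  have e3 := map_thetaPsi (θ.comp ε) (K := K) (by simpa [hX] using hy)
  have e4 := map_thetaPsi ((θ.comp ε).comp evalNegHom) (K := K) (by simpa [hX] using hy')
  have e5 := map_thetaPsi ((θ.comp ε).comp ε) (K := K) (by simpa [hX] using sq_pow_eq_zero hy)
  simp only [RingHom.comp_apply, evalNegHom_X, map_neg, hX, map_pow] at e2 e3 e4 e5
  have h := mockThetaBSum_mul_psiPartial_sq hθ
  rw [← e1, ← e2, ← e3, ← e4, ← e5] at h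
  simp only [← hε, map_mul, map_add, map_pow, map_ofNat]
  exact h

end Hom

theorem expand_injective {p : ℕ} (hp : p ≠ 0) :
    Function.Injective (expand p hp : ℤ⟦X⟧ → ℤ⟦X⟧) := fun f g h => by
  ext n
  have := congrArg (coeff (p * n)) h
  rwa [coeff_expand_mul, coeff_expand_mul] at this

theorem mockThetaBEven_mul_evalNegHom_thetaPsi_sq :
    mockThetaBEven * evalNegHom thetaPsi ^ 2 =
      thetaPsi ^ 2 * expand 2 two_ne_zero thetaPsi := by
  have key : (mockThetaB + evalNegHom mockThetaB) *
      expand 2 two_ne_zero (evalNegHom thetaPsi) ^ 2 = 2 * expand 2 two_ne_zero thetaPsi ^ 2 *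
        expand 2 two_ne_zero (expand 2 two_ne_zero thetaPsi) := by
    rw [← sub_eq_zero]
    ext n
    rw [map_zero]
    refine X_pow_dvd_iff.mp ?_ n (Nat.lt_succ_self n)
    rw [← Ideal.mem_span_singleton, ← Ideal.Quotient.eq_zero_iff_mem, map_sub, sub_eq_zero]
    refine map_mockThetaB_mul_thetaPsi_sq _ (K := n + 1) ?_
    rw [← map_pow]
    exact Ideal.Quotient.eq_zero_iff_mem.mpr (Ideal.mem_span_singleton_self _)
  rw [mockThetaB_add_neg] at key
  refine expand_injective two_ne_zero (mul_left_cancel₀ two_ne_zero_powerSeries ?_)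
  simp only [map_mul, map_pow]
  linear_combination key

theorem thetaPsi_ne_zero : thetaPsi ≠ 0 := fun h => by
  have h1 := congrArg (coeff 0) h
  rw [thetaPsi, coeff_latticeSum_eq_sum {0}] at h1
  · simp at h1
  · intro m hm
    have := le_triangle m
    simp
    omega

theorem mockThetaBEven_mul_thetaPhiNeg : mockThetaBEven * thetaPhiNeg = thetaPsi ^ 2 := by
  have h := mockThetaBEven_mul_evalNegHom_thetaPsi_sq
  rw [evalNegHom_thetaPsi_sq] at h
  have h0 : expand 2 two_ne_zero thetaPsi ≠ 0 := fun h' =>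
    thetaPsi_ne_zero (expand_injective two_ne_zero (by rw [h', map_zero]))
  refine mul_left_cancel₀ h0 ?_
  linear_combination h

/-! ### The progression `6n + 4` -/

/-- The power series of the coefficients of `f` in the progression `3n + i`. -/
noncomputable def sectionThree (i : ℕ) (f : ℤ⟦X⟧) : ℤ⟦X⟧ :=
  PowerSeries.mk fun n => coeff (3 * n + i) f

theorem eq_add_expand_sectionThree (f : ℤ⟦X⟧) :
    f = expand 3 three_ne_zero (sectionThree 0 f) + X * expand 3 three_ne_zero (sectionThree 1 f) +
      X ^ 2 * expand 3 three_ne_zero (sectionThree 2 f) := by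
  ext n
  rw [map_add, map_add, ← pow_one (X : ℤ⟦X⟧), ← pow_mul, coeff_X_pow_mul', coeff_X_pow_mul',
    coeff_expand, coeff_expand, coeff_expand]
  simp only [sectionThree, coeff_mk]
  rcases (show n % 3 = 0 ∨ n % 3 = 1 ∨ n % 3 = 2 by omega) with h | h | h
  · rw [if_pos (by omega), show 3 * (n / 3) + 0 = n by omega]
    split_ifs <;> omega
  · rw [if_neg (by omega), if_pos (by omega), if_pos (by omega),
      show 3 * ((n - 1) / 3) + 1 = n by omega]
    split_ifs <;> omega
  · rw [if_neg (by omega), if_pos (by omega), if_neg (by omega), if_pos (by omega),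
      if_pos (by omega), show 3 * ((n - 1 * 2) / 3) + 2 = n by omega]
    simp

theorem eq_of_expand_three_add_eq {f₀ f₁ f₂ g₀ g₁ g₂ : ℤ⟦X⟧}
    (h : expand 3 three_ne_zero f₀ + X * expand 3 three_ne_zero f₁ +
        X ^ 2 * expand 3 three_ne_zero f₂ =
      expand 3 three_ne_zero g₀ + X * expand 3 three_ne_zero g₁ +
        X ^ 2 * expand 3 three_ne_zero g₂) : f₂ = g₂ := by
  have key : ∀ (a b c : ℤ⟦X⟧) (n : ℕ), coeff (3 * n + 2) (expand 3 three_ne_zero a +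
      X * expand 3 three_ne_zero b + X ^ 2 * expand 3 three_ne_zero c) = coeff n c := by
    intro a b c n
    rw [map_add, map_add, coeff_X_pow_mul, coeff_expand_mul, coeff_succ_X_mul,
      coeff_expand_of_not_dvd _ _ _ (by omega), coeff_expand_of_not_dvd _ _ _ (by omega)]
    ring
  ext n
  rw [← key f₀ f₁ f₂, h, key]

/-- The generating function of `b(6n + 4)`: with `D = φ(-q³)³ - 8qΩ³`, where `Ω = f(-q, -q⁵)`, one has
`(∑ b(6n + 4) qⁿ) D = 9 ψ(q³)² φ(-q³)²`. -/
theorem sectionThree_mockThetaBEven_mul :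
    sectionThree 2 mockThetaBEven * (expand 3 three_ne_zero thetaPhiNeg ^ 3 -
        8 * X * thetaOct ^ 3) =
      9 * (expand 3 three_ne_zero thetaPsi * expand 3 three_ne_zero thetaPhiNeg) ^ 2 := by
  have h := mockThetaBEven_mul_thetaPhiNeg
  rw [thetaPhiNeg_split, thetaPsi_split] at h
  have hAb := thetaPent_mul_thetaOct
  have hE := eq_add_expand_sectionThree mockThetaBEven
  set E₀ := sectionThree 0 mockThetaBEven
  set E₁ := sectionThree 1 mockThetaBEven
  set E₂ := sectionThree 2 mockThetaBEven
  set a := expand 3 three_ne_zero thetaPhiNeg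
  set p := expand 3 three_ne_zero thetaPsi
  set b := thetaOct
  set A := thetaPent
  have hX : expand 3 three_ne_zero (X : ℤ⟦X⟧) = X ^ 3 := expand_X 3 three_ne_zero
  -- `(a³ - 8qb³)(q³)` is the product of `φ(-q) = a(q³) - 2q b(q³)` and `(a² + 2abq + 4b²q²)`, the
  -- latter with `a`, `b` taken at `q³`
  have key := eq_of_expand_three_add_eq
    (f₀ := E₀ * (a ^ 3 - 8 * X * b ^ 3)) (f₁ := E₁ * (a ^ 3 - 8 * X * b ^ 3))
    (f₂ := E₂ * (a ^ 3 - 8 * X * b ^ 3))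
    (g₀ := A ^ 2 * a ^ 2 + X * (8 * A * p * b ^ 2 + 2 * p ^ 2 * a * b))
    (g₁ := 2 * A ^ 2 * a * b + 2 * A * p * a ^ 2 + X * (4 * p ^ 2 * b ^ 2))
    (g₂ := (2 * A * b + p * a) ^ 2) ?_
  · rw [key]
    linear_combination 4 * (A * b + 2 * p * a) * hAb
  · rw [hE] at h
    simp only [map_mul, map_add, map_sub, map_pow, map_ofNat, hX]
    linear_combination (expand 3 three_ne_zero a ^ 2 + 2 * X * expand 3 three_ne_zero a *
      expand 3 three_ne_zero b + 4 * X ^ 2 * expand 3 three_ne_zero b ^ 2) * h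

theorem constantCoeff_thetaPhiNeg : constantCoeff thetaPhiNeg = 1 := by
  rw [← coeff_zero_eq_constantCoeff_apply, thetaPhiNeg, coeff_latticeSum_eq_sum {0}]
  · simp [signChar]
  · intro k hk
    simpa using hk

/-- `∑ b(6n + 4) qⁿ ≡ 9 ψ(q⁶)` modulo `36`. -/
theorem sectionThree_mockThetaBEven : ∃ H, sectionThree 2 mockThetaBEven =
    9 * expand 3 three_ne_zero (expand 2 two_ne_zero thetaPsi) + 36 * H := by
  have h := sectionThree_mockThetaBEven_mul
  obtain ⟨g, hg⟩ := thetaPhi_mul_thetaPhiNeg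
  obtain ⟨g', hg'⟩ := thetaPhiNeg_sq
  have h1 := congrArg (expand 3 three_ne_zero) hg'
  have h2 := congrArg (expand 3 three_ne_zero) hg
  have h3 := congrArg (expand 3 three_ne_zero) thetaPsi_sq
  simp only [map_add, map_mul, map_pow, map_one, map_ofNat] at h1 h2 h3
  have hu : IsUnit (expand 3 three_ne_zero thetaPhiNeg ^ 3 - 8 * X * thetaOct ^ 3) := by
    rw [isUnit_iff_constantCoeff]
    simp [constantCoeff_expand, constantCoeff_thetaPhiNeg]
  obtain ⟨D, hD⟩ := hu.exists_right_inv
  set a := expand 3 three_ne_zero thetaPhiNeg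
  set p := expand 3 three_ne_zero thetaPsi
  set c := expand 3 three_ne_zero thetaPhi
  set s := expand 3 three_ne_zero (expand 2 two_ne_zero thetaPsi)
  set G := expand 3 three_ne_zero g
  set G' := expand 3 three_ne_zero g'
  set E := sectionThree 2 mockThetaBEven
  set b := thetaOct
  set Q := (p * a) ^ 2 * D with hQ
  have hE : E = 9 * Q := by
    rw [hQ]
    linear_combination D * h - E * hD
  have hQD : Q * (a ^ 3 - 8 * X * b ^ 3) = (p * a) ^ 2 := by
    rw [hQ]
    linear_combination (p * a) ^ 2 * hD
  refine ⟨s * G + p ^ 2 * a * G' - Q * (2 * G' + 4 * G' ^ 2 - 2 * X * a * b ^ 3), ?_⟩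
  rw [hE]
  linear_combination 9 * a * hQD - 9 * Q * (a ^ 2 + 1 + 4 * G') * h1 + 9 * p ^ 2 * a * h1 +
    9 * a * h3 + 9 * s * h2

theorem coeff_expand_thetaPsi (n : ℕ) [Decidable (∃ m, 3 * (m * (m + 1)) = n)] :
    coeff n (expand 3 three_ne_zero (expand 2 two_ne_zero thetaPsi)) =
      if ∃ m, 3 * (m * (m + 1)) = n then 1 else 0 := by
  have he : ∀ m, 3 * (2 * (m * (m + 1) / 2)) = 3 * (m * (m + 1)) := fun m => by
    rw [Nat.mul_div_cancel' (Nat.even_mul_succ_self m).two_dvd]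
  rw [thetaPsi, ← latticeSum_expand, ← latticeSum_expand]
  simp_rw [he]
  split_ifs with h
  · obtain ⟨m, hm⟩ := h
    rw [coeff_latticeSum_eq_sum {m}]
    · rw [Finset.sum_singleton, if_pos hm]
    · intro i hi
      rw [Finset.mem_singleton]
      nlinarith [lt_trichotomy i m]
  · rw [coeff_latticeSum_eq_sum ∅ fun i hi => (h ⟨i, hi⟩).elim, Finset.sum_empty]

open Classical in
theorem mockThetaBCoeff_six_mul_add_four (n : ℕ) : mockThetaBCoeff (6 * n + 4) ≡
    9 * (if ∃ m, 3 * (m * (m + 1)) = n then 1 else 0) [ZMOD 36] := by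
  obtain ⟨H, hH⟩ := sectionThree_mockThetaBEven
  have h := congrArg (coeff n) hH
  rw [sectionThree, coeff_mk, mockThetaBEven, coeff_mk, map_add, ← map_ofNat (C (R := ℤ)) 9,
    ← map_ofNat (C (R := ℤ)) 36, coeff_C_mul, coeff_C_mul, coeff_expand_thetaPsi,
    show 2 * (3 * n + 2) = 6 * n + 4 by ring] at h
  rw [h]
  exact (Int.modEq_iff_add_fac.mpr ⟨_, rfl⟩).symm

/-! ### The congruences -/

/-- In terms of `N = 4n + 3` the condition `n = 3m(m + 1)` reads `N = 3(2m + 1)²`, and the left side is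
the same condition for `P²N`. -/
theorem exists_three_mul_iff {P t : ℕ} (hP : P = 2 * t + 1) (h3 : P.Coprime 3) (n : ℕ) :
    (∃ m, 3 * (m * (m + 1)) = P ^ 2 * n + 3 * (t * (t + 1))) ↔ ∃ m, 3 * (m * (m + 1)) = n := by
  constructor
  · rintro ⟨M, hM⟩
    have h1 : 3 * (2 * M + 1) ^ 2 = P ^ 2 * (4 * n + 3) := by
      rw [hP] at hM ⊢
      linear_combination 4 * hM
    have h2 : P ∣ 2 * M + 1 := by
      rw [← Nat.pow_dvd_pow_iff two_ne_zero]
      exact (h3.pow_left 2).dvd_of_dvd_mul_left ⟨_, h1⟩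
    obtain ⟨s, hs⟩ := h2
    have hodd : Odd s := by
      have : Odd (P * s) := hs ▸ odd_two_mul_add_one M
      exact (Nat.odd_mul.mp this).2
    obtain ⟨m, rfl⟩ := hodd
    have hpos : 0 < P ^ 2 := by rw [hP]; positivity
    refine ⟨m, ?_⟩
    have h4 : P ^ 2 * (3 * (2 * m + 1) ^ 2) = P ^ 2 * (4 * n + 3) := by
      rw [← h1, hs]
      ring
    have h5 := Nat.eq_of_mul_eq_mul_left hpos h4
    nlinarith
  -- `2M + 1 = P (2m + 1)`
  · rintro ⟨m, rfl⟩
    refine ⟨P * m + t, ?_⟩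
    rw [hP]
    ring

theorem neg_one_zpow_modEq {p r : ℕ} (hr : p = 2 * r + 1) (k : ℕ) :
    (((-1 : ℤˣ) ^ (((k : ℤ) + 1) * (1 - (p : ℤ)) / 2) : ℤˣ) : ℤ) ≡ (p : ℤ) ^ (k + 1) [ZMOD 4] := by
  have h1 : ((k : ℤ) + 1) * (1 - (p : ℤ)) / 2 = -((r * (k + 1) : ℕ) : ℤ) := by
    rw [hr]
    push_cast
    rw [show ((k : ℤ) + 1) * (1 - (2 * r + 1)) = 2 * -(r * (k + 1)) by ring,
      Int.mul_ediv_cancel_left _ two_ne_zero]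
  rw [h1, zpow_neg, zpow_natCast, Int.units_inv_eq_self, pow_mul, Units.val_pow_eq_pow_val,
    Units.val_pow_eq_pow_val, Units.val_neg, Units.val_one]
  refine Int.ModEq.pow _ ?_
  rcases Nat.even_or_odd' r with ⟨c, rfl | rfl⟩
  · rw [pow_mul, neg_one_sq, one_pow, hr]
    push_cast
    exact Int.modEq_iff_dvd.mpr ⟨c, by ring⟩
  · rw [pow_succ, pow_mul, neg_one_sq, one_pow, hr]
    push_cast
    exact Int.modEq_iff_dvd.mpr ⟨c + 1, by ring⟩

theorem nine_mul_modEq {a b : ℤ} (h : a ≡ b [ZMOD 4]) : 9 * a ≡ 9 * b [ZMOD 36] :=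
  h.mul_left' (c := 9)

theorem theorem1p3 (p : ℕ) [Fact p.Prime] (hp : 5 ≤ p) :
    (∀ ℓ : ℕ, 1 ≤ ℓ → ℓ ≤ p - 1 → legendreSym p (12 * (ℓ : ℤ) + 9) = -1 →
      ∀ n : ℕ, mockThetaBCoeff (6 * (p * n + ℓ) + 4) ≡ 0 [ZMOD 36]) ∧
    (∀ n k : ℕ,
      (∀ u v : ℤ, 9 * u ≡ 1 [ZMOD 4] → (p : ℤ) * v ≡ 1 [ZMOD 36] →
        mockThetaBCoeff (6 * n + 4) ≡
          u ^ (k + 1) * (((-1 : ℤˣ) ^ (((k : ℤ) + 1) * (1 - (p : ℤ)) / 2) : ℤˣ) : ℤ) *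
            v ^ (k + 1) *
            mockThetaBCoeff (6 * p ^ (2 * k + 2) * n + (9 * p ^ (2 * k + 2) - 1) / 2)
          [ZMOD 36]) ∧
      9 ^ (k + 1) * (p : ℤ) ^ (k + 1) * mockThetaBCoeff (6 * n + 4) ≡
        (((-1 : ℤˣ) ^ (((k : ℤ) + 1) * (1 - (p : ℤ)) / 2) : ℤˣ) : ℤ) *
          mockThetaBCoeff (6 * p ^ (2 * k + 2) * n + (9 * p ^ (2 * k + 2) - 1) / 2)
        [ZMOD 36]) := by
  classical
  have hprime : p.Prime := Fact.out
  refine ⟨fun ℓ _ _ hℓ n => ?_, fun n k => ?_⟩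
  · have h := mockThetaBCoeff_six_mul_add_four (p * n + ℓ)
    rw [if_neg, mul_zero] at h
    · convert h
    rintro ⟨m, hm⟩
    refine (legendreSym.eq_neg_one_iff p).mp hℓ ⟨6 * m + 3, ?_⟩
    have h1 := congrArg (Nat.cast : ℕ → ZMod p) hm
    push_cast at h1 ⊢
    rw [CharP.cast_eq_zero (ZMod p) p] at h1
    linear_combination -12 * h1
  obtain ⟨r, hr⟩ := hprime.odd_of_ne_two (by omega)
  have hε := neg_one_zpow_modEq hr k
  set ε : ℤ := (((-1 : ℤˣ) ^ (((k : ℤ) + 1) * (1 - (p : ℤ)) / 2) : ℤˣ) : ℤ)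
  obtain ⟨t, ht⟩ : Odd (p ^ (k + 1)) := Odd.pow ⟨r, hr⟩
  have hcop : (p ^ (k + 1)).Coprime 3 := by
    refine Nat.Coprime.pow_left _ ((Nat.coprime_primes hprime Nat.prime_three).mpr (by omega))
  have hb := mockThetaBCoeff_six_mul_add_four n
  have hb' := mockThetaBCoeff_six_mul_add_four ((p ^ (k + 1)) ^ 2 * n + 3 * (t * (t + 1)))
  simp only [exists_three_mul_iff ht hcop n] at hb'
  have hidx : 6 * ((p ^ (k + 1)) ^ 2 * n + 3 * (t * (t + 1))) + 4 =
      6 * p ^ (2 * k + 2) * n + (9 * p ^ (2 * k + 2) - 1) / 2 := by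
    have h1 : p ^ (2 * k + 2) = (p ^ (k + 1)) ^ 2 := by ring
    have h2 : 9 * (p ^ (k + 1)) ^ 2 = 2 * (18 * (t * (t + 1)) + 4) + 1 := by
      rw [ht]
      ring
    rw [h1, h2, Nat.add_sub_cancel, Nat.mul_div_cancel_left _ two_pos]
    ring
  rw [hidx] at hb'
  set c : ℤ := if ∃ m, 3 * (m * (m + 1)) = n then 1 else 0
  refine ⟨fun u v hu hv => ?_, ?_⟩
  · have hu' : u ≡ 1 [ZMOD 4] := by
      refine Int.ModEq.trans ?_ hu
      exact Int.modEq_iff_dvd.mpr ⟨2 * u, by ring⟩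
    have hv' : (p : ℤ) * v ≡ 1 [ZMOD 4] := hv.of_dvd (by norm_num)
    have h1 : u ^ (k + 1) * ε * v ^ (k + 1) ≡ 1 [ZMOD 4] := by
      have := ((hu'.pow (k + 1)).mul hε).mul_right (v ^ (k + 1))
      rw [one_pow, one_mul, ← mul_pow] at this
      simpa using this.trans (hv'.pow (k + 1))
    have h2 := nine_mul_modEq (h1.mul_right c)
    refine hb.trans (Int.ModEq.symm ?_)
    refine (hb'.mul_left _).trans ?_
    rw [one_mul] at h2
    rwa [mul_left_comm]
  · have h9 : (9 : ℤ) ^ (k + 1) ≡ 1 [ZMOD 4] := by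
      simpa using (show (9 : ℤ) ≡ 1 [ZMOD 4] by decide).pow (k + 1)
    have h1 : (9 : ℤ) ^ (k + 1) * (p : ℤ) ^ (k + 1) ≡ ε [ZMOD 4] := by
      simpa using h9.mul hε.symm
    have h2 := nine_mul_modEq (h1.mul_right c)
    refine (hb.mul_left _).trans (Int.ModEq.trans ?_ (hb'.mul_left _).symm)
    rwa [mul_left_comm, mul_left_comm ε]
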